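/- Let $n\ge 1$ and let $M$ be a closed connected smooth manifold of real dimension $2n+2$ with a Vaisman structure $(J,g,\theta)$: $J$ is an integrable almost complex structure, $g$ is a $J$-Hermitian metric, and $\theta$ is a 1-form, parallel for the Levi-Civita connection of $g$ and normalized by $\|\theta\|_g=1$, such that the fundamental form $\omega(X,Y)=g(X,JY)$ satisfies $d\omega=\theta\wedge\omega$ ($\theta$ is called the Lee form). Let $J$ act on 1-forms by $(J\alpha)(v)=-\alpha(Jv)$, put $\theta^c=J\theta$, $U=\theta^\sharp$, $V=(\theta^c)^\sharp$, and let $\Sigma=\langle U,V\rangle$ be the canonical foliation. A smooth differential form $\alpha$ (of degree $0$ or $1$ below) is called basic if $\iota_X\alpha=0$ and $\mathrm{Lie}_X\alpha=0$ for all vector fields $X$ tangent to $\Sigma$; for a basic function $\varphi$ put $d_b^c\varphi=J\,d\varphi$, that is, $(d_b^c\varphi)(v)=-d\varphi(Jv)$. Exterior derivatives and wedge products are normalized without numerical factors, e.g. $d\alpha(X,Y)=X\alpha(Y)-Y\alpha(X)-\alpha([X,Y])$. Call a 1-form $\zeta$ admissible if it is basic, $d\zeta$ is of type $(1,1)$ with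 respect to $J$ (i.e. $d\zeta(JX,JY)=d\zeta(X,Y)$), at every point $$\|\zeta\|<\frac{1}{(2^{n+1}-1)\,n^{\frac{n-1}{2}}},\qquad \|d\zeta\|<\frac{1}{(2^{n+1}-1)\,n^{\frac{n-1}{2}}}$$ (where $\|\zeta\|^2=\sum_i\zeta(e_i)^2$ and $\|d\zeta\|^2=\sum_{i<j}d\zeta(e_i,e_j)^2$ in $g$-orthonormal bases), and $d\zeta(Jv,v)>-1$ for every $g$-unit tangent vector $v$. Let $\varphi$ be a globally defined smooth basic function on $M$. Then there is $\varepsilon>0$ such that for all $t\in\mathbb R$ with $|t|<\varepsilon$ the following hold. The form $\zeta_t=t\,d_b^c\varphi$ is admissible. The tensor field $$g_t=g+t\left(dd_b^c\varphi\circ(J\otimes \mathrm{Id})+d_b^c\varphi\otimes\theta^c+\theta^c\otimes d_b^c\varphi\right)+t^2\,d_b^c\varphi\otimes d_b^c\varphi$$ is a Riemannian metric. With $J_t=J-U\otimes\zeta_t-V\otimes(\zeta_t\circ J)$, the triple $(M,J_t,g_t)$ is a Vaisman manifold with Lee form $\theta$, and $\|\theta\|_{g_t}=1$. Finally, the fields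 $g_t$-dual to $\theta$ and to $\theta_t^c=J_t\theta$ are again $U$ and $V$, so that the canonical foliation is unchanged. Thus $(J_t,g_t)_{|t|<\varepsilon}$ is a family of Vaisman deformations of $(J_0,g_0)=(J,g)$. -/

import Mathlib

open Set Bundle Manifold VectorField
open scoped ContDiff

namespace VaismanDeformation

/-! Tensor fields on a manifold `M` modelled on `ℝ^m`. -/

section Tensors

variable {m : ℕ} {M : Type*} [TopologicalSpace M] [ChartedSpace (EuclideanSpace ℝ (Fin m)) M]

variable (m M) in
/-- Vector fields, i.e. sections of `TM` (no regularity). -/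
abbrev VField := (x : M) → TangentSpace (𝓡 m) x

variable (m M) in
/-- Sections of `T*M` (no regularity). -/
abbrev OneForm := (x : M) → (TangentSpace (𝓡 m) x →L[ℝ] ℝ)

variable (m M) in
/-- Sections of `End(TM)` (no regularity). -/
abbrev EndField := (x : M) → (TangentSpace (𝓡 m) x →L[ℝ] TangentSpace (𝓡 m) x)

variable (m M) in
/-- Fields of `(0,2)`-tensors, given by their values on pairs of tangent vectors. -/
abbrev TwoTensor := (x : M) → TangentSpace (𝓡 m) x → TangentSpace (𝓡 m) x → ℝ

/-- The derivative `v(f)` of a real function `f` at `x` along the tangent vector `v`. -/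
noncomputable def dirDeriv (f : M → ℝ) (x : M) (v : TangentSpace (𝓡 m) x) : ℝ :=
  mvfderiv (𝓡 m) f x v

variable [IsManifold (𝓡 m) ∞ M]

/-- Smooth vector fields. -/
def SmoothVField (X : VField m M) : Prop :=
  ContMDiff (𝓡 m) ((𝓡 m).prod 𝓘(ℝ, EuclideanSpace ℝ (Fin m))) ∞
    (fun x ↦ TotalSpace.mk' (EuclideanSpace ℝ (Fin m)) (E := fun x : M ↦ TangentSpace (𝓡 m) x)
      x (X x))

/-- Smooth 1-forms. -/
def SmoothOneForm (α : OneForm m M) : Prop :=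
  ContMDiff (𝓡 m) ((𝓡 m).prod 𝓘(ℝ, EuclideanSpace ℝ (Fin m) →L[ℝ] ℝ)) ∞
    (fun x ↦ TotalSpace.mk' (EuclideanSpace ℝ (Fin m) →L[ℝ] ℝ)
      (E := fun x : M ↦ (TangentSpace (𝓡 m) x →L[ℝ] ℝ)) x (α x))

/-- Smooth fields of endomorphisms of the tangent bundle. -/
def SmoothEndField (J : EndField m M) : Prop :=
  ContMDiff (𝓡 m)
    ((𝓡 m).prod 𝓘(ℝ, EuclideanSpace ℝ (Fin m) →L[ℝ] EuclideanSpace ℝ (Fin m))) ∞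
    (fun x ↦ TotalSpace.mk' (EuclideanSpace ℝ (Fin m) →L[ℝ] EuclideanSpace ℝ (Fin m))
      (E := fun x : M ↦ (TangentSpace (𝓡 m) x →L[ℝ] TangentSpace (𝓡 m) x)) x (J x))

/-- `dα(X, Y) = X(α(Y)) - Y(α(X)) - α([X, Y])` for a 1-form `α`. -/
noncomputable def dOneFormOn (α : OneForm m M) (X Y : VField m M) (x : M) : ℝ :=
  dirDeriv (fun y ↦ α y (Y y)) x (X x) - dirDeriv (fun y ↦ α y (X y)) x (Y x)
    - α x (mlieBracket (𝓡 m) X Y x)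

/-- The exterior derivative of a 1-form as a tensor: `dα_x(v, w)` is computed with local
extensions of `v` and `w` to vector fields. By `dOneForm_apply` below the value does not depend
on the extensions. -/
noncomputable def dOneForm (α : OneForm m M) : TwoTensor m M := fun x v w ↦
  dOneFormOn α (FiberBundle.extend (EuclideanSpace ℝ (Fin m)) v)
    (FiberBundle.extend (EuclideanSpace ℝ (Fin m)) w) x

theorem SmoothOneForm.mdifferentiableAt_apply {α : OneForm m M} (hα : SmoothOneForm α)
    {X : VField m M} {x : M}
    (hX : MDifferentiableAt (𝓡 m) (𝓡 m).tangent (fun y ↦ (X y : TangentBundle (𝓡 m) M)) x) :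
    MDifferentiableAt (𝓡 m) 𝓘(ℝ, ℝ) (fun y ↦ α y (X y)) x := by
  have h : MDifferentiableAt (𝓡 m) ((𝓡 m).prod 𝓘(ℝ, ℝ))
      (fun y ↦ TotalSpace.mk' ℝ (E := Bundle.Trivial M ℝ) y (α y (X y))) x :=
    MDifferentiableAt.clm_bundle_apply (F₁ := EuclideanSpace ℝ (Fin m))
      (E₁ := fun y : M ↦ TangentSpace (𝓡 m) y) (hα.mdifferentiableAt (by simp)) hX
  simp only [mdifferentiableAt_totalSpace] at h
  exact h.2

theorem dOneFormOn_swap (α : OneForm m M) (X Y : VField m M) (x : M) :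
    dOneFormOn α X Y x = -dOneFormOn α Y X x := by
  simp only [dOneFormOn]
  rw [mlieBracket_swap_apply, map_neg]
  ring

theorem tensorialAt_dOneFormOn {α : OneForm m M} (hα : SmoothOneForm α) (X : VField m M)
    (x : M) :
    TensorialAt (𝓡 m) (EuclideanSpace ℝ (Fin m)) (fun Y ↦ dOneFormOn α X Y x) x where
  smul {f Y} hf hY := by
    have h1 := hα.mdifferentiableAt_apply hY
    have h2 : (fun y ↦ α y ((f • Y) y)) = fun y ↦ f y * α y (Y y) := by
      funext y; simp
    simp only [dOneFormOn, dirDeriv]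
    rw [h2, mvfderiv_fun_mul hf h1, mlieBracket_smul_right hf hY]
    simp
    ring
  add {Y Z} hY hZ := by
    have h2 : (fun y ↦ α y ((Y + Z) y)) = fun y ↦ α y (Y y) + α y (Z y) := by
      funext y; simp
    simp only [dOneFormOn, dirDeriv]
    rw [h2, mvfderiv_fun_add (hα.mdifferentiableAt_apply hY) (hα.mdifferentiableAt_apply hZ),
      mlieBracket_add_right hY hZ]
    simp
    ring

/-- For a smooth 1-form, `dα_x(X_x, Y_x)` is given by the invariant formula for all vector fields
`X`, `Y` that are differentiable at `x`. -/
theorem dOneForm_apply {α : OneForm m M} (hα : SmoothOneForm α) {X Y : VField m M} {x : M}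
    (hX : MDifferentiableAt (𝓡 m) (𝓡 m).tangent (fun y ↦ (X y : TangentBundle (𝓡 m) M)) x)
    (hY : MDifferentiableAt (𝓡 m) (𝓡 m).tangent (fun y ↦ (Y y : TangentBundle (𝓡 m) M)) x) :
    dOneForm α x (X x) (Y x) = dOneFormOn α X Y x := by
  refine TensorialAt.pointwise₂ (I := 𝓡 m) (F := EuclideanSpace ℝ (Fin m))
    (F' := EuclideanSpace ℝ (Fin m)) (Φ := fun X Y ↦ dOneFormOn α X Y x) (fun Z _ ↦ ?_)
    (fun Z _ ↦ tensorialAt_dOneFormOn hα Z x) (FiberBundle.mdifferentiableAt_extend ..) hX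
    (FiberBundle.mdifferentiableAt_extend ..) hY (by simp) (by simp)
  have h := tensorialAt_dOneFormOn hα Z x
  constructor
  · intro f σ hf hσ
    have := h.smul hf hσ
    simp only [dOneFormOn_swap α _ Z x, this, smul_neg]
  · intro σ σ' hσ hσ'
    have := h.add hσ hσ'
    simp only [dOneFormOn_swap α _ Z x, this, neg_add]

/-- The exterior derivative of a 2-form `β`, evaluated on vector fields:
`dβ(X,Y,Z) = Xβ(Y,Z) + Yβ(Z,X) + Zβ(X,Y) - β([X,Y],Z) - β([Y,Z],X) - β([Z,X],Y)`. -/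
noncomputable def dTwoFormOn (β : TwoTensor m M) (X Y Z : VField m M) (x : M) : ℝ :=
  dirDeriv (fun y ↦ β y (Y y) (Z y)) x (X x) + dirDeriv (fun y ↦ β y (Z y) (X y)) x (Y x)
    + dirDeriv (fun y ↦ β y (X y) (Y y)) x (Z x)
    - β x (mlieBracket (𝓡 m) X Y x) (Z x) - β x (mlieBracket (𝓡 m) Y Z x) (X x)
    - β x (mlieBracket (𝓡 m) Z X x) (Y x)

/-- The wedge product `α ∧ β` of a 1-form and a 2-form. -/
noncomputable def wedgeOneTwo (α : OneForm m M) (β : TwoTensor m M) (x : M) (u v w : TangentSpace (𝓡 m) x) : ℝ :=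
  α x u * β x v w + α x v * β x w u + α x w * β x u v

/-- The Lie derivative of a 1-form: `(Lie_X α)(Y) = X(α(Y)) - α([X, Y])`. -/
noncomputable def lieDerivOneForm (X : VField m M) (α : OneForm m M) (Y : VField m M) (x : M) : ℝ :=
  dirDeriv (fun y ↦ α y (Y y)) x (X x) - α x (mlieBracket (𝓡 m) X Y x)

/-- The Nijenhuis tensor `N(X,Y) = J²[X,Y] - J[JX,Y] - J[X,JY] + [JX,JY]`. -/
noncomputable def nijenhuis (J : EndField m M) (X Y : VField m M) (x : M) : TangentSpace (𝓡 m) x :=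
  J x (J x (mlieBracket (𝓡 m) X Y x)) - J x (mlieBracket (𝓡 m) (fun y ↦ J y (X y)) Y x)
    - J x (mlieBracket (𝓡 m) X (fun y ↦ J y (Y y)) x)
    + mlieBracket (𝓡 m) (fun y ↦ J y (X y)) (fun y ↦ J y (Y y)) x

/-- The action of `J` on 1-forms, `(Jα)(v) = -α(Jv)`. -/
noncomputable def actOneForm (J : EndField m M) (α : OneForm m M) : OneForm m M :=
  fun x ↦ -((α x).comp (J x))

/-- The operator `d^c = J d J⁻¹` on functions (on which `J⁻¹` acts trivially), with values in
1-forms: `(d^c φ)(v) = -dφ(Jv)`. -/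
noncomputable def dc (J : EndField m M) (φ : M → ℝ) : OneForm m M :=
  actOneForm J (fun x ↦ mvfderiv (𝓡 m) φ x)

/-- A 2-form is of type (1,1) with respect to `J` if it is `J`-invariant. -/
def IsOneOne (J : EndField m M) (β : TwoTensor m M) : Prop :=
  ∀ x v w, β x (J x v) (J x w) = β x v w

end Tensors

section Metrics

variable {m : ℕ} {M : Type*} [TopologicalSpace M] [ChartedSpace (EuclideanSpace ℝ (Fin m)) M]
  [IsManifold (𝓡 m) ∞ M]

variable (m M) in
/-- Smooth Riemannian metrics on `M`. -/
abbrev SmoothMetric := ContMDiffRiemannianMetric (𝓡 m) ∞ (EuclideanSpace ℝ (Fin m))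
  (fun x : M ↦ TangentSpace (𝓡 m) x)

theorem exists_sharp (g : SmoothMetric m M) (θ : OneForm m M) (x : M) :
    ∃ u : TangentSpace (𝓡 m) x, ∀ w, g.inner x u w = θ x w := by
  have : FiniteDimensional ℝ (TangentSpace (𝓡 m) x) :=
    inferInstanceAs (FiniteDimensional ℝ (EuclideanSpace ℝ (Fin m)))
  let B : TangentSpace (𝓡 m) x →ₗ[ℝ] Module.Dual ℝ (TangentSpace (𝓡 m) x) :=
    { toFun := fun u ↦ (g.inner x u : TangentSpace (𝓡 m) x →ₗ[ℝ] ℝ)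
      map_add' := fun u v ↦ by ext w; simp
      map_smul' := fun c v ↦ by ext w; simp }
  have hB : Function.Injective B := by
    rw [injective_iff_map_eq_zero]
    intro u hu
    by_contra hne
    have h1 := g.pos x u hne
    have h2 : g.inner x u u = 0 := congrArg (fun f ↦ f u) hu
    exact absurd h2 h1.ne'
  have hs : Function.Surjective B :=
    (LinearMap.injective_iff_surjective_of_finrank_eq_finrank
      (Subspace.dual_finrank_eq).symm).1 hB
  obtain ⟨u, hu⟩ := hs (θ x : TangentSpace (𝓡 m) x →ₗ[ℝ] ℝ)
  exact ⟨u, fun w ↦ congrArg (fun f ↦ f w) hu⟩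

/-- The vector field `θ^♯` which is `g`-dual to the 1-form `θ`. -/
noncomputable def sharp (g : SmoothMetric m M) (θ : OneForm m M) : VField m M :=
  fun x ↦ (exists_sharp g θ x).choose

theorem sharp_spec (g : SmoothMetric m M) (θ : OneForm m M) (x : M) (w : TangentSpace (𝓡 m) x) :
    g.inner x (sharp g θ x) w = θ x w :=
  (exists_sharp g θ x).choose_spec w

/-- A connection on `TM` is the Levi-Civita connection of `g` if it is torsion-free and metric:
`v(g(Y,Z)) = g(∇_v Y, Z) + g(Y, ∇_v Z)`. -/
structure IsLeviCivita (g : SmoothMetric m M)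
    (D : CovariantDerivative (𝓡 m) (EuclideanSpace ℝ (Fin m))
      (fun x : M ↦ TangentSpace (𝓡 m) x)) : Prop where
  torsion_eq_zero : D.torsion = 0
  metric : ∀ Y Z : VField m M, SmoothVField Y → SmoothVField Z → ∀ (x : M)
    (v : TangentSpace (𝓡 m) x),
    dirDeriv (fun y ↦ g.inner y (Y y) (Z y)) x v
      = g.inner x (D Y x v) (Z x) + g.inner x (Y x) (D Z x v)

/-- The 1-form `θ` is parallel for the Levi-Civita connection of `g`:
`(∇_v θ)(Y) = v(θ(Y)) - θ(∇_v Y) = 0`. -/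
def IsParallel (g : SmoothMetric m M) (θ : OneForm m M) : Prop :=
  ∃ D : CovariantDerivative (𝓡 m) (EuclideanSpace ℝ (Fin m)) (fun x : M ↦ TangentSpace (𝓡 m) x),
    IsLeviCivita g D ∧ ∀ Y : VField m M, SmoothVField Y → ∀ (x : M) (v : TangentSpace (𝓡 m) x),
      dirDeriv (fun y ↦ θ y (Y y)) x v - θ x (D Y x v) = 0

/-- The fundamental 2-form `ω(v, w) = g(v, Jw)`. -/
noncomputable def fundForm (J : EndField m M) (g : SmoothMetric m M) : TwoTensor m M :=
  fun x v w ↦ g.inner x v (J x w)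

/-- `J` is a complex structure: a smooth almost complex structure which is integrable. -/
structure IsComplexStructure (J : EndField m M) : Prop where
  smooth : SmoothEndField J
  sq : ∀ x v, J x (J x v) = -v
  integrable : ∀ X Y : VField m M, SmoothVField X → SmoothVField Y → ∀ x, nijenhuis J X Y x = 0

/-- `(M, J, g)` is a Vaisman manifold with Lee form `θ`, normalized by `‖θ‖_g = 1`. -/
structure IsVaisman (J : EndField m M) (g : SmoothMetric m M) (θ : OneForm m M) : Prop where
  complex : IsComplexStructure J
  hermitian : ∀ x v w, g.inner x (J x v) (J x w) = g.inner x v w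
  smooth : SmoothOneForm θ
  unit : ∀ x, g.inner x (sharp g θ x) (sharp g θ x) = 1
  parallel : IsParallel g θ
  lee : ∀ X Y Z : VField m M, SmoothVField X → SmoothVField Y → SmoothVField Z → ∀ x,
    dTwoFormOn (fundForm J g) X Y Z x = wedgeOneTwo θ (fundForm J g) x (X x) (Y x) (Z x)

/-- The anti-Lee form `θ^c = Jθ`, that is `θ^c(v) = -θ(Jv)`. -/
noncomputable def antiLee (J : EndField m M) (θ : OneForm m M) : OneForm m M := actOneForm J θ

/-- The Lee field `U = θ^♯`. -/
noncomputable def leeField (g : SmoothMetric m M) (θ : OneForm m M) : VField m M := sharp g θ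

/-- The anti-Lee field `V = (θ^c)^♯`. -/
noncomputable def antiLeeField (J : EndField m M) (g : SmoothMetric m M) (θ : OneForm m M) :
    VField m M := sharp g (antiLee J θ)

/-- Smooth vector fields tangent to the canonical foliation `Σ = ⟨U, V⟩`. -/
def IsLeafwise (J : EndField m M) (g : SmoothMetric m M) (θ : OneForm m M) (X : VField m M) : Prop :=
  SmoothVField X ∧ ∀ x, X x ∈ Submodule.span ℝ {leeField g θ x, antiLeeField J g θ x}

/-- Basic functions for the canonical foliation (the contraction condition is void for
functions): `Lie_X φ = X(φ) = 0` for all leafwise `X`. -/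
def IsBasicFunction (J : EndField m M) (g : SmoothMetric m M) (θ : OneForm m M) (φ : M → ℝ) : Prop :=
  ContMDiff (𝓡 m) 𝓘(ℝ, ℝ) ∞ φ ∧
    ∀ X : VField m M, IsLeafwise J g θ X → ∀ x, dirDeriv φ x (X x) = 0

/-- Basic 1-forms for the canonical foliation: `ι_X α = 0` and `Lie_X α = 0` for all
leafwise `X`. -/
def IsBasicOneForm (J : EndField m M) (g : SmoothMetric m M) (θ α : OneForm m M) : Prop :=
  SmoothOneForm α ∧ ∀ X : VField m M, IsLeafwise J g θ X →
    (∀ x, α x (X x) = 0) ∧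
    ∀ Y : VField m M, SmoothVField Y → ∀ x, lieDerivOneForm X α Y x = 0

/-- `e` is a `g`-orthonormal basis of `T_x M` (`m` orthonormal vectors, `m = dim T_x M`). -/
def IsOrthonormalFrame (g : SmoothMetric m M) (x : M) (e : Fin m → TangentSpace (𝓡 m) x) : Prop :=
  ∀ i j, g.inner x (e i) (e j) = if i = j then 1 else 0

/-- `‖α‖ < C` at every point, where `‖α‖² = ∑ i, α(e_i)²` in an orthonormal basis. -/
def OneFormNormLT (g : SmoothMetric m M) (α : OneForm m M) (C : ℝ) : Prop :=
  ∀ (x : M) (e : Fin m → TangentSpace (𝓡 m) x), IsOrthonormalFrame g x e →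
    √(∑ i, α x (e i) ^ 2) < C

/-- `‖β‖ < C` at every point, where `‖β‖² = ∑ i < j, β(e_i, e_j)²` in an orthonormal basis. -/
def TwoFormNormLT (g : SmoothMetric m M) (β : TwoTensor m M) (C : ℝ) : Prop :=
  ∀ (x : M) (e : Fin m → TangentSpace (𝓡 m) x), IsOrthonormalFrame g x e →
    √(∑ i, ∑ j, if i < j then β x (e i) (e j) ^ 2 else 0) < C

/-- The constant `1 / ((2^(n+1) - 1) n^((n-1)/2))`. -/
noncomputable def smallness (n : ℕ) : ℝ :=
  1 / (((2 : ℝ) ^ (n + 1) - 1) * (n : ℝ) ^ (((n : ℝ) - 1) / 2))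

/-- Admissible 1-forms on a Vaisman manifold of real dimension `m = 2n + 2`: basic forms `ζ` with
`dζ` of type (1,1), `‖ζ‖` and `‖dζ‖` below the constant above, and
`dζ(Jv, v) > -1` for every unit vector `v`. -/
structure IsAdmissible (n : ℕ) (J : EndField m M) (g : SmoothMetric m M) (θ ζ : OneForm m M) :
    Prop where
  basic : IsBasicOneForm J g θ ζ
  oneOne : IsOneOne J (dOneForm ζ)
  norm_lt : OneFormNormLT g ζ (smallness n)
  norm_d_lt : TwoFormNormLT g (dOneForm ζ) (smallness n)
  positive : ∀ (x : M) (v : TangentSpace (𝓡 m) x), g.inner x v v = 1 →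
    -1 < dOneForm ζ x (J x v) v

/-- The deformed structure `J_ζ = J - U ⊗ ζ - V ⊗ (ζ ∘ J)`. -/
noncomputable def deformedJ (J : EndField m M) (g : SmoothMetric m M) (θ ζ : OneForm m M) :
    EndField m M := fun x ↦
  J x - (ζ x).smulRight (leeField g θ x) - ((ζ x).comp (J x)).smulRight (antiLeeField J g θ x)

end Metrics

end VaismanDeformation

open VaismanDeformation

namespace VaismanDeformation

open Filter Topology

/-! ### Calculus of smooth vector fields -/

section Calculus

variable {m : ℕ} {M : Type*} [TopologicalSpace M] [ChartedSpace (EuclideanSpace ℝ (Fin m)) M]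

/-! Structure of a Vaisman manifold. The Lee field `U` is dual to a parallel form, hence Killing.
Contracting `dω = θ ∧ ω` with `U` and using Cartan's formula gives `g(Y, (L_U J)Z) + dθ^c(Y,Z) = (ω
+ θ ∧ θ^c)(Y,Z)`. The first term is `J`-anti-invariant and the others are `J`-invariant, so it
vanishes. Thus `U` is holomorphic, `ω = dθ^c - θ ∧ θ^c`, and `V = JU` is holomorphic because `J` is
integrable. In particular `g = dθ^c(J·,·) + θ ⊗ θ + θ^c ⊗ θ^c` (`IsVaisman.inner_eq`).

Deformation. Let `ζ` be basic with `dζ` of type (1,1), and put `η = θ^c + ζ`. Then `J_ζ` differs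
from `J` by leafwise vectors and `J_ζ θ = η`. Since `ι_U dη = ι_V dη = 0`, the form `dη` does not
distinguish `J_ζ` from `J`, and the deformed metric is again `dη(J_ζ·,·) + θ ⊗ θ + η ⊗ η`
(`deformedMetric_eq`). Symmetry, the Hermitian property, the dual fields `U`, `V` and the
fundamental form `dη - θ ∧ η` are read off from this; the Lee equation follows from `dθ = 0`. The
Nijenhuis tensors of `J_ζ` and `J` differ by multiples of `U` and `V` whose coefficients measure the
failure of `dζ` to be of type (1,1) (`nijenhuis_deformedJ`). Finally, `U` preserves `dη`, `θ`, `η`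
and `J_ζ`, so it is Killing for the new metric, and a closed form with Killing dual is parallel
(`isParallel_of_isKilling`). The Levi-Civita connection needed here is obtained by correcting that
of `g` (`exists_isLeviCivita`).

Application. For `ζ = t d^cφ`, basicness holds because `U` and `V` are holomorphic and annihilate
`φ`; type (1,1) holds because `dφ` is closed and `J` is integrable. On compact `M` a smooth bilinear
form is bounded by a multiple of `g`, so for small `t` all strict inequalities, including positivity
of the metric, hold (`eventually_small`). -/

theorem two_le_infty : (2 : WithTop ℕ∞) ≤ ∞ :=
  WithTop.coe_le_coe.2 (le_top : (2 : ℕ∞) ≤ ⊤)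

theorem three_le_infty : (3 : WithTop ℕ∞) ≤ ∞ :=
  WithTop.coe_le_coe.2 (le_top : (3 : ℕ∞) ≤ ⊤)

/-- Smooth real functions. -/
abbrev SmoothFun (f : M → ℝ) : Prop := ContMDiff (𝓡 m) 𝓘(ℝ, ℝ) ∞ f

/-- The derivative of a function along a vector field. -/
noncomputable def der (X : VField m M) (f : M → ℝ) : M → ℝ := fun x ↦ dirDeriv f x (X x)

/-- The Lie bracket of vector fields. -/
noncomputable abbrev lie (X Y : VField m M) : VField m M := mlieBracket (𝓡 m) X Y

variable {f h : M → ℝ} {x : M} {X Y Z : VField m M}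

theorem SmoothFun.mdiffAt (hf : SmoothFun (m := m) f) (x : M) :
    MDifferentiableAt (𝓡 m) 𝓘(ℝ, ℝ) f x := hf.mdifferentiableAt (by simp)

theorem SmoothFun.add (hf : SmoothFun (m := m) f) (hh : SmoothFun (m := m) h) :
    SmoothFun (m := m) (f + h) := ContMDiff.add hf hh

theorem SmoothFun.sub (hf : SmoothFun (m := m) f) (hh : SmoothFun (m := m) h) :
    SmoothFun (m := m) (f - h) := ContMDiff.sub hf hh

theorem SmoothFun.neg (hf : SmoothFun (m := m) f) : SmoothFun (m := m) (-f) := ContMDiff.neg hf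

theorem SmoothFun.mul (hf : SmoothFun (m := m) f) (hh : SmoothFun (m := m) h) :
    SmoothFun (m := m) (f * h) := ContMDiff.mul hf hh

theorem der_const (c : ℝ) : der X (fun _ ↦ c) = 0 := by
  funext x; simp [der, dirDeriv, mvfderiv_const]

theorem der_add (hf : SmoothFun (m := m) f) (hh : SmoothFun (m := m) h) :
    der X (f + h) = der X f + der X h := by
  funext x; simp [der, dirDeriv, mvfderiv_add (hf.mdiffAt x) (hh.mdiffAt x)]

theorem der_sub (hf : SmoothFun (m := m) f) (hh : SmoothFun (m := m) h) :
    der X (f - h) = der X f - der X h := by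
  funext x; simp [der, dirDeriv, mvfderiv_sub (hf.mdiffAt x) (hh.mdiffAt x)]

theorem der_neg (f : M → ℝ) : der X (-f) = -der X f := by
  funext x; simp [der, dirDeriv, mvfderiv_neg]

theorem der_mul (hf : SmoothFun (m := m) f) (hh : SmoothFun (m := m) h) :
    der X (f * h) = f * der X h + h * der X f := by
  funext x; simp [der, dirDeriv, mvfderiv_mul (hf.mdiffAt x) (hh.mdiffAt x)]

theorem der_const_mul (hf : SmoothFun (m := m) f) (c : ℝ) :
    der X (fun x ↦ c * f x) = fun x ↦ c * der X f x := by
  have := der_mul (X := X) (f := fun _ ↦ c) contMDiff_const hf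
  rw [der_const] at this
  funext x
  simpa using! congrFun this x

variable [IsManifold (𝓡 m) ∞ M]

theorem SmoothVField.mdiffAt (hX : SmoothVField X) (x : M) :
    MDifferentiableAt (𝓡 m) (𝓡 m).tangent (fun y ↦ (X y : TangentBundle (𝓡 m) M)) x :=
  hX.mdifferentiableAt (by simp)

theorem SmoothVField.der (hX : SmoothVField X) (hf : SmoothFun (m := m) f) :
    SmoothFun (m := m) (der X f) := by
  -- `X(f)` is the fibre component of the composite of `X` with the tangent map of `f`.
  have h1 := (contMDiff_snd_tangentBundle_modelSpace ℝ 𝓘(ℝ, ℝ) (n := ∞)).comp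
    ((hf.contMDiff_tangentMap (m := ∞) (by simp)).comp hX)
  exact h1

theorem SmoothVField.add (hX : SmoothVField X) (hY : SmoothVField Y) : SmoothVField (X + Y) :=
  ContMDiff.add_section hX hY

theorem SmoothVField.sub (hX : SmoothVField X) (hY : SmoothVField Y) : SmoothVField (X - Y) :=
  ContMDiff.sub_section hX hY

theorem SmoothVField.neg (hX : SmoothVField X) : SmoothVField (-X) :=
  ContMDiff.neg_section hX

theorem SmoothVField.smul (hX : SmoothVField X) (hf : SmoothFun (m := m) f) :
    SmoothVField (f • X) :=
  ContMDiff.smul_section hf hX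

theorem SmoothVField.lie (hX : SmoothVField X) (hY : SmoothVField Y) :
    SmoothVField (lie X Y) := by
  have : IsManifold (𝓡 m) ((⊤ : ℕ∞) + 1) M := inferInstanceAs (IsManifold (𝓡 m) ∞ M)
  have : IsManifold (𝓡 m) (minSmoothness ℝ 2) M :=
    IsManifold.of_le (n := ∞) (by simpa using two_le_infty)
  exact ContDiff.mlieBracket_vectorField (n := ⊤) (m := ⊤) hX hY (by simp)

omit [IsManifold (𝓡 m) ∞ M] in
theorem lie_swap : lie X Y = -lie Y X := mlieBracket_swap

theorem lie_add_left (hX : SmoothVField X) (hY : SmoothVField Y) :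
    lie (X + Y) Z = lie X Z + lie Y Z := by
  funext x; exact mlieBracket_add_left (hX.mdiffAt x) (hY.mdiffAt x)

theorem lie_add_right (hX : SmoothVField X) (hY : SmoothVField Y) :
    lie Z (X + Y) = lie Z X + lie Z Y := by
  funext x; exact mlieBracket_add_right (hX.mdiffAt x) (hY.mdiffAt x)

theorem lie_smul_right (hX : SmoothVField X) (hf : SmoothFun (m := m) f) :
    lie Z (f • X) = der Z f • X + f • lie Z X := by
  funext x; exact mlieBracket_smul_right (hf.mdiffAt x) (hX.mdiffAt x)

theorem lie_smul_left (hX : SmoothVField X) (hf : SmoothFun (m := m) f) :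
    lie (f • X) Z = -(der Z f • X) + f • lie X Z := by
  rw [lie_swap, lie_smul_right hX hf, lie_swap (X := Z), neg_add, smul_neg, neg_neg]

theorem lie_neg_left (hX : SmoothVField X) : lie (-X) Z = -lie X Z := by
  have := lie_smul_left (f := fun _ ↦ -1) (Z := Z) hX contMDiff_const
  rw [der_const] at this
  have h2 : (fun _ : M ↦ (-1 : ℝ)) • X = -X := by funext x; simp
  rw [h2] at this
  rw [this]; funext x; simp

theorem lie_neg_right (hX : SmoothVField X) : lie Z (-X) = -lie Z X := by
  rw [lie_swap, lie_neg_left hX, lie_swap (X := Z)]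

theorem lie_sub_left (hX : SmoothVField X) (hY : SmoothVField Y) :
    lie (X - Y) Z = lie X Z - lie Y Z := by
  rw [sub_eq_add_neg, lie_add_left hX hY.neg, lie_neg_left hY, ← sub_eq_add_neg]

theorem lie_sub_right (hX : SmoothVField X) (hY : SmoothVField Y) :
    lie Z (X - Y) = lie Z X - lie Z Y := by
  rw [sub_eq_add_neg, lie_add_right hX hY.neg, lie_neg_right hY, ← sub_eq_add_neg]

theorem lie_jacobi (hX : SmoothVField X) (hY : SmoothVField Y) (hZ : SmoothVField Z) :
    lie X (lie Y Z) = lie (lie X Y) Z + lie Y (lie X Z) := by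
  have : IsManifold (𝓡 m) (minSmoothness ℝ 3) M :=
    IsManifold.of_le (n := ∞) (by simpa using three_le_infty)
  have h2 : minSmoothness ℝ 2 ≤ ∞ := by simpa using two_le_infty
  exact leibniz_identity_mlieBracket (hX.of_le h2) (hY.of_le h2) (hZ.of_le h2)

theorem SmoothOneForm.apply {α : OneForm m M} (hα : SmoothOneForm α) (hX : SmoothVField X) :
    SmoothFun (m := m) (fun y ↦ α y (X y)) := by
  have h : ContMDiff (𝓡 m) ((𝓡 m).prod 𝓘(ℝ, ℝ)) ∞
      (fun y ↦ TotalSpace.mk' ℝ (E := Bundle.Trivial M ℝ) y (α y (X y))) :=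
    ContMDiff.clm_bundle_apply (F₁ := EuclideanSpace ℝ (Fin m))
      (E₁ := fun y : M ↦ TangentSpace (𝓡 m) y) hα hX
  intro x
  exact (contMDiffAt_totalSpace.1 (h x)).2

theorem SmoothEndField.apply {J : EndField m M} (hJ : SmoothEndField J) (hX : SmoothVField X) :
    SmoothVField (fun y ↦ J y (X y)) :=
  ContMDiff.clm_bundle_apply (F₁ := EuclideanSpace ℝ (Fin m))
      (E₁ := fun y : M ↦ TangentSpace (𝓡 m) y) hJ hX

theorem smoothFun_inner (g : SmoothMetric m M) (hX : SmoothVField X) (hY : SmoothVField Y) :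
    SmoothFun (m := m) (fun y ↦ g.inner y (X y) (Y y)) := by
  have h : ContMDiff (𝓡 m) ((𝓡 m).prod 𝓘(ℝ, ℝ)) ∞
      (fun y ↦ TotalSpace.mk' ℝ (E := Bundle.Trivial M ℝ) y (g.inner y (X y) (Y y))) :=
    ContMDiff.clm_bundle_apply₂ (F₁ := EuclideanSpace ℝ (Fin m))
      (F₂ := EuclideanSpace ℝ (Fin m))
      (E₁ := fun y : M ↦ TangentSpace (𝓡 m) y) (E₂ := fun y : M ↦ TangentSpace (𝓡 m) y)
      g.contMDiff hX hY
  intro x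
  exact (contMDiffAt_totalSpace.1 (h x)).2

/-- A local field is cut off by a bump function supported in the trivializing set and equal to 1
near `x`. -/
theorem exists_smoothVField_eventuallyEq [T2Space M] {x : M} {X : VField m M}
    {e : Trivialization (EuclideanSpace ℝ (Fin m))
      (TotalSpace.proj : TangentBundle (𝓡 m) M → M)} (hx : x ∈ e.baseSet)
    (hX : ContMDiffOn (𝓡 m) ((𝓡 m).prod 𝓘(ℝ, EuclideanSpace ℝ (Fin m))) ∞
      (fun y ↦ TotalSpace.mk' (EuclideanSpace ℝ (Fin m)) (E := fun y : M ↦ TangentSpace (𝓡 m) y)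
        y (X y)) e.baseSet) :
    ∃ Y : VField m M, SmoothVField Y ∧ Y =ᶠ[𝓝 x] X := by
  obtain ⟨f, -, hf⟩ := (SmoothBumpFunction.nhds_basis_tsupport (I := 𝓡 m) x).mem_iff.1
    (e.open_baseSet.mem_nhds hx)
  refine ⟨(f : M → ℝ) • X, ContMDiffOn.smul_section_of_tsupport f.contMDiff.contMDiffOn
    e.open_baseSet hf hX, ?_⟩
  filter_upwards [f.eventuallyEq_one] with y hy
  change f y • X y = X y
  rw [hy, Pi.one_apply, one_smul]

/-- Near every point there is a frame of the tangent bundle consisting of globally defined smooth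
vector fields. -/
theorem exists_smooth_frame [T2Space M] (x : M) (c : EuclideanSpace ℝ (Fin m)) :
    ∃ X : VField m M, SmoothVField X ∧ ∀ᶠ y in 𝓝 x,
      X y = (trivializationAt (EuclideanSpace ℝ (Fin m)) (fun y : M ↦ TangentSpace (𝓡 m) y) x).symm
        y c := by
  let e := trivializationAt (EuclideanSpace ℝ (Fin m)) (fun y : M ↦ TangentSpace (𝓡 m) y) x
  have he : x ∈ e.baseSet := FiberBundle.mem_baseSet_trivializationAt' x
  refine exists_smoothVField_eventuallyEq (X := fun y ↦ e.symm y c) he ?_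
  rw [e.contMDiffOn_section_baseSet_iff]
  apply (contMDiffOn_const (c := c)).congr
  intro y hy
  simp [e.apply_mk_symm hy]

/-- This allows pointwise identities between tensors to be checked on globally smooth fields. -/
theorem exists_smoothVField_apply_eq [T2Space M] (x : M) (v : TangentSpace (𝓡 m) x) :
    ∃ X : VField m M, SmoothVField X ∧ X x = v := by
  let e := trivializationAt (EuclideanSpace ℝ (Fin m)) (fun y : M ↦ TangentSpace (𝓡 m) y) x
  have he : x ∈ e.baseSet := FiberBundle.mem_baseSet_trivializationAt' x
  obtain ⟨X, hX, h⟩ := exists_smooth_frame x (e ⟨x, v⟩).2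
  refine ⟨X, hX, h.self_of_nhds.trans ?_⟩
  exact e.symm_apply_apply_mk he v

/-- Comparing the Jacobi identity for `X`, `Y`, `fW` with `f` times that for `X`, `Y`, `W` leaves
`([X,Y]f - XYf + YXf) W = 0`. A field `W` with nonzero value at `x` then gives the claim. -/
theorem der_lie [T2Space M] (hX : SmoothVField X) (hY : SmoothVField Y)
    (hf : SmoothFun (m := m) f) :
    der (lie X Y) f = der X (der Y f) - der Y (der X f) := by
  funext x
  have key : ∀ W : VField m M, SmoothVField W →
      (der (lie X Y) f x - (der X (der Y f) x - der Y (der X f) x)) • W x = 0 := by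
    intro W hW
    have h1 := congrFun (lie_jacobi hX hY (hW.smul hf)) x
    rw [lie_smul_right hW hf, lie_smul_right hW hf, lie_smul_right hW hf,
      lie_add_right (hW.smul (hY.der hf)) ((hY.lie hW).smul hf),
      lie_add_right (hW.smul (hX.der hf)) ((hX.lie hW).smul hf),
      lie_smul_right hW (hY.der hf), lie_smul_right hW (hX.der hf),
      lie_smul_right (hY.lie hW) hf, lie_smul_right (hX.lie hW) hf, lie_jacobi hX hY hW] at h1
    simp only [Pi.add_apply, Pi.smul_apply'] at h1
    rw [← sub_eq_zero] at h1
    rw [← neg_eq_zero, ← h1]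
    module
  by_cases hne : ∃ v : TangentSpace (𝓡 m) x, v ≠ 0
  · obtain ⟨v, hv⟩ := hne
    obtain ⟨W, hW, rfl⟩ := exists_smoothVField_apply_eq x v
    have := (smul_eq_zero.1 (key W hW)).resolve_right hv
    simp only [Pi.sub_apply]
    linarith
  -- If the tangent space at `x` is zero, all derivatives at `x` vanish.
  · push Not at hne
    have h0 (X : VField m M) (f : M → ℝ) : der X f x = 0 := by
      simp [der, hne (X x), dirDeriv]
    simp [h0]

end Calculus

/-! ### Smoothness of tensor fields -/

section TensorSmoothness

variable {m : ℕ} {M : Type*} [TopologicalSpace M] [ChartedSpace (EuclideanSpace ℝ (Fin m)) M]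

/-- A linear map on a finite-dimensional space is a fixed linear combination of its values on a
basis, so smoothness of those values suffices. -/
theorem contMDiffAt_clm_of_basis {W : Type*} [NormedAddCommGroup W] [NormedSpace ℝ W]
    {L : M → EuclideanSpace ℝ (Fin m) →L[ℝ] W} {x : M}
    (h : ∀ c, ContMDiffAt (𝓡 m) 𝓘(ℝ, W) ∞ (fun y ↦ L y c) x) :
    ContMDiffAt (𝓡 m) 𝓘(ℝ, EuclideanSpace ℝ (Fin m) →L[ℝ] W) ∞ L x := by
  let b := EuclideanSpace.basisFun (Fin m) ℝ
  let R : Fin m → W →L[ℝ] (EuclideanSpace ℝ (Fin m) →L[ℝ] W) := fun i ↦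
    ContinuousLinearMap.smulRightL ℝ (EuclideanSpace ℝ (Fin m)) W (EuclideanSpace.proj i)
  have hL : L = fun y ↦ ∑ i, R i (L y (b i)) := by
    funext y
    apply ContinuousLinearMap.ext
    intro c
    have hc : c = ∑ i, c i • b i := by
      simpa using! (b.sum_repr c).symm
    conv_lhs => rw [hc]
    simp [R]
  rw [hL]
  refine contMDiffAt_finsetSum fun i _ ↦ ?_
  exact (R i).contMDiff.contMDiffAt.comp x (h (b i))

variable [IsManifold (𝓡 m) ∞ M] [T2Space M]

/-- A field of linear maps on the tangent spaces is smooth if it maps smooth vector fields to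
smooth sections. -/
theorem contMDiff_hom_of_apply {F : Type*} [NormedAddCommGroup F] [NormedSpace ℝ F]
    {E : M → Type*} [∀ x, AddCommGroup (E x)] [∀ x, Module ℝ (E x)]
    [TopologicalSpace (TotalSpace F E)] [∀ x, TopologicalSpace (E x)]
    [∀ x, IsTopologicalAddGroup (E x)] [∀ x, ContinuousSMul ℝ (E x)]
    [FiberBundle F E] [VectorBundle ℝ F E]
    {φ : (x : M) → (TangentSpace (𝓡 m) x →L[ℝ] E x)}
    (h : ∀ X : VField m M, SmoothVField X → ContMDiff (𝓡 m) ((𝓡 m).prod 𝓘(ℝ, F)) ∞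
      (fun x ↦ TotalSpace.mk' F (E := E) x (φ x (X x)))) :
    ContMDiff (𝓡 m) ((𝓡 m).prod 𝓘(ℝ, EuclideanSpace ℝ (Fin m) →L[ℝ] F)) ∞
      (fun x ↦ TotalSpace.mk' (EuclideanSpace ℝ (Fin m) →L[ℝ] F)
        (E := fun x : M ↦ (TangentSpace (𝓡 m) x →L[ℝ] E x)) x (φ x)) := by
  intro x
  rw [contMDiffAt_hom_bundle]
  refine ⟨contMDiffAt_id, contMDiffAt_clm_of_basis fun c ↦ ?_⟩
  obtain ⟨X, hX, hXc⟩ := exists_smooth_frame x c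
  refine ((contMDiffAt_section x).1 (h X hX x)).congr_of_eventuallyEq ?_
  have he := (trivializationAt (EuclideanSpace ℝ (Fin m))
    (fun y : M ↦ TangentSpace (𝓡 m) y) x).open_baseSet.mem_nhds
      (FiberBundle.mem_baseSet_trivializationAt' x)
  have he' := (trivializationAt F E x).open_baseSet.mem_nhds
      (FiberBundle.mem_baseSet_trivializationAt' x)
  filter_upwards [hXc, he, he'] with y hy h1 h2
  rw [ContinuousLinearMap.inCoordinates_eq h1 h2]
  simp [hy]

theorem SmoothOneForm.of_apply {α : OneForm m M}
    (h : ∀ X : VField m M, SmoothVField X → SmoothFun (m := m) (fun y ↦ α y (X y))) :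
    SmoothOneForm α := by
  refine contMDiff_hom_of_apply (F := ℝ) (E := Bundle.Trivial M ℝ) fun X hX x ↦ ?_
  rw [contMDiffAt_totalSpace]
  exact ⟨contMDiffAt_id, h X hX x⟩

theorem SmoothEndField.of_apply {J : EndField m M}
    (h : ∀ X : VField m M, SmoothVField X → SmoothVField (fun y ↦ J y (X y))) :
    SmoothEndField J :=
  contMDiff_hom_of_apply (E := fun x : M ↦ TangentSpace (𝓡 m) x) h

/-- A bilinear form is a map into the cotangent bundle, so the criterion for homomorphism fields is
applied twice. -/
theorem contMDiff_bilin_of_apply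
    {β : (x : M) → (TangentSpace (𝓡 m) x →L[ℝ] TangentSpace (𝓡 m) x →L[ℝ] ℝ)}
    (h : ∀ X Y : VField m M, SmoothVField X → SmoothVField Y →
      SmoothFun (m := m) (fun y ↦ β y (X y) (Y y))) :
    ContMDiff (𝓡 m)
      ((𝓡 m).prod 𝓘(ℝ, EuclideanSpace ℝ (Fin m) →L[ℝ] EuclideanSpace ℝ (Fin m) →L[ℝ] ℝ)) ∞
      (fun x ↦ TotalSpace.mk' (EuclideanSpace ℝ (Fin m) →L[ℝ] EuclideanSpace ℝ (Fin m) →L[ℝ] ℝ)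
        (E := fun x : M ↦ (TangentSpace (𝓡 m) x →L[ℝ] TangentSpace (𝓡 m) x →L[ℝ] ℝ)) x (β x)) :=
  contMDiff_hom_of_apply (F := EuclideanSpace ℝ (Fin m) →L[ℝ] ℝ)
    (E := fun x : M ↦ (TangentSpace (𝓡 m) x →L[ℝ] ℝ))
    fun X hX ↦ SmoothOneForm.of_apply fun Y hY ↦ h X Y hX hY

omit [T2Space M] in
/-- The vector field dual to a smooth 1-form is smooth. -/
theorem smoothVField_sharp (g : SmoothMetric m M) {θ : OneForm m M} (hθ : SmoothOneForm θ) :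
    SmoothVField (sharp g θ) := by
  intro x
  rw [contMDiffAt_section]
  set e := trivializationAt (EuclideanSpace ℝ (Fin m)) (fun y : M ↦ TangentSpace (𝓡 m) y) x
    with he
  have hx : x ∈ e.baseSet := FiberBundle.mem_baseSet_trivializationAt' x
  have hg := (contMDiffAt_hom_bundle _).1 (g.contMDiff x)
  have hθ' := (contMDiffAt_hom_bundle _).1 (hθ x)
  replace hg := hg.2
  replace hθ' := hθ'.2
  simp only [TotalSpace.mk'] at hg hθ'
  -- In the trivialization at `x` the metric becomes a smooth family `G` of maps from the model
  -- space to its dual and `θ` a smooth family `T`. The dual field is `G⁻¹ T`, which is smooth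
  -- because inversion of linear maps is smooth at an invertible one.
  set G := fun y ↦ ContinuousLinearMap.inCoordinates (EuclideanSpace ℝ (Fin m))
    (fun y : M ↦ TangentSpace (𝓡 m) y) (EuclideanSpace ℝ (Fin m) →L[ℝ] ℝ)
    (fun y : M ↦ (TangentSpace (𝓡 m) y →L[ℝ] ℝ)) x y x y (g.inner y) with hG
  set T := fun y ↦ ContinuousLinearMap.inCoordinates (EuclideanSpace ℝ (Fin m))
    (fun y : M ↦ TangentSpace (𝓡 m) y) ℝ (Bundle.Trivial M ℝ) x y x y (θ y) with hT
  have hGa : ∀ y ∈ e.baseSet, ∀ v w, G y v w = g.inner y (e.symm y v) (e.symm y w) := by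
    intro y hy v w
    simp only [hG]
    rw [inCoordinates_apply_eq₂ hy hy (Set.mem_univ _)]
    simp [he]
  have hTa : ∀ y ∈ e.baseSet, ∀ w, T y w = θ y (e.symm y w) := by
    intro y hy w
    simp only [hT]
    rw [ContinuousLinearMap.inCoordinates_eq hy (Set.mem_univ _)]
    simp [he]
  have hinv : ∀ y ∈ e.baseSet, (G y).IsInvertible := by
    intro y hy
    have hinj : Function.Injective (G y) := by
      rw [injective_iff_map_eq_zero]
      intro v hv
      by_contra hne
      have h1 : e.symm y v ≠ 0 := by
        intro h0
        apply hne
        have := e.apply_mk_symm hy v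
        rw [h0] at this
        have h3 := congrArg Prod.snd (e.zeroSection ℝ hy)
        have h4 := congrArg Prod.snd this
        exact h4.symm.trans h3
      have h2 := g.pos y _ h1
      rw [← hGa y hy, hv] at h2
      simp at h2
    have hfr : Module.finrank ℝ (EuclideanSpace ℝ (Fin m))
        = Module.finrank ℝ (EuclideanSpace ℝ (Fin m) →L[ℝ] ℝ) := by
      rw [← (LinearMap.toContinuousLinearMap (𝕜 := ℝ)
        (E := EuclideanSpace ℝ (Fin m)) (F' := ℝ)).finrank_eq]
      exact (Subspace.dual_finrank_eq).symm
    exact ⟨(LinearEquiv.ofInjectiveOfFinrankEq (G y : _ →ₗ[ℝ] _) hinj hfr).toContinuousLinearEquiv,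
      by ext v; rfl⟩
  have hsmooth : ContMDiffAt (𝓡 m) 𝓘(ℝ, EuclideanSpace ℝ (Fin m)) ∞
      (fun y ↦ (G y).inverse (T y)) x := by
    have h1 : ContMDiffAt (𝓡 m) 𝓘(ℝ, (EuclideanSpace ℝ (Fin m) →L[ℝ] ℝ) →L[ℝ]
        EuclideanSpace ℝ (Fin m)) ∞ (fun y ↦ (G y).inverse) x := by
      obtain ⟨E, hE⟩ := hinv x hx
      have h2 := contDiffAt_map_inverse (n := ∞) E
      rw [hE] at h2
      exact h2.contMDiffAt.comp x hg
    exact h1.clm_apply hθ'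
  refine hsmooth.congr_of_eventuallyEq ?_
  filter_upwards [e.open_baseSet.mem_nhds hx] with y hy
  obtain ⟨E, hE⟩ := hinv y hy
  have h1 : T y = G y (e ⟨y, sharp g θ y⟩).2 := by
    ext w
    rw [hTa y hy, hGa y hy, ← sharp_spec g θ, e.symm_apply_apply_mk hy]
  rw [h1, ← hE, ContinuousLinearMap.inverse_equiv]
  simp

end TensorSmoothness

/-! ### Bilinear forms on the tangent spaces -/

/-- On the compact unit sphere `b v v` has a positive minimum `b u u`; by homogeneity `b u u * ‖v‖ ^
2 ≤ b v v` everywhere. -/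
theorem isVonNBounded_of_pos {E : Type*} [NormedAddCommGroup E] [NormedSpace ℝ E]
    [FiniteDimensional ℝ E] (b : E →L[ℝ] E →L[ℝ] ℝ) (hb : ∀ v, v ≠ 0 → 0 < b v v) :
    Bornology.IsVonNBounded ℝ {v : E | b v v < 1} := by
  rw [NormedSpace.isVonNBounded_iff]
  by_cases hne : (Metric.sphere (0 : E) 1).Nonempty
  · obtain ⟨u, hu, hmin⟩ := (isCompact_sphere (0 : E) 1).exists_isMinOn hne
      (f := fun v ↦ b v v) (b.continuous.clm_apply continuous_id).continuousOn
    have hu0 : 0 < b u u := hb u (by rintro rfl; simp at hu)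
    refine (Metric.isBounded_closedBall (x := (0 : E)) (r := √(1 / b u u))).subset fun v hv ↦ ?_
    rw [mem_closedBall_zero_iff]
    by_cases hv0 : v = 0
    · simp [hv0]
    have hvn : 0 < ‖v‖ := norm_pos_iff.2 hv0
    have h1 : b u u ≤ b (‖v‖⁻¹ • v) (‖v‖⁻¹ • v) :=
      hmin (by simp [norm_smul, inv_mul_cancel₀ hvn.ne'])
    simp only [map_smul, smul_apply, smul_eq_mul] at h1
    have h2 : b u u * ‖v‖ ^ 2 ≤ b v v := by
      have := mul_le_mul_of_nonneg_right h1 (sq_nonneg ‖v‖)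
      refine this.trans_eq ?_
      field_simp
    apply Real.le_sqrt_of_sq_le
    rw [le_div_iff₀ hu0, mul_comm]
    exact h2.trans (le_of_lt hv)
  -- An empty unit sphere means that the space is zero.
  · refine (Metric.isBounded_closedBall (x := (0 : E)) (r := 0)).subset fun v _ ↦ ?_
    rw [mem_closedBall_zero_iff]
    by_contra hv
    push Not at hv
    exact hne ⟨‖v‖⁻¹ • v, by simp [norm_smul, inv_mul_cancel₀ hv.ne']⟩

section Bilinear

variable {m : ℕ} {M : Type*} [TopologicalSpace M] [ChartedSpace (EuclideanSpace ℝ (Fin m)) M]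

instance (x : M) : FiniteDimensional ℝ (TangentSpace (𝓡 m) x) :=
  inferInstanceAs (FiniteDimensional ℝ (EuclideanSpace ℝ (Fin m)))

instance (x : M) : T2Space (TangentSpace (𝓡 m) x) :=
  inferInstanceAs (T2Space (EuclideanSpace ℝ (Fin m)))

theorem exists_bilin (B : TwoTensor m M) (h : ∀ x, IsBilinearMap ℝ (B x)) :
    ∃ β : (x : M) → (TangentSpace (𝓡 m) x →L[ℝ] TangentSpace (𝓡 m) x →L[ℝ] ℝ),
      ∀ x v w, β x v w = B x v w :=
  ⟨fun x ↦ (h x).toLinearMap.toContinuousBilinearMap, fun _ _ _ ↦ rfl⟩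

variable [IsManifold (𝓡 m) ∞ M]

/-- Locally, `β` has bounded norm in a trivialization by continuity, and the trivialization has
bounded norm with respect to `g`. Finitely many such neighbourhoods cover the compact `M`. -/
theorem exists_bound_of_contMDiff [CompactSpace M] (g : SmoothMetric m M)
    {β : (x : M) → (TangentSpace (𝓡 m) x →L[ℝ] TangentSpace (𝓡 m) x →L[ℝ] ℝ)}
    (hβ : ContMDiff (𝓡 m)
      ((𝓡 m).prod 𝓘(ℝ, EuclideanSpace ℝ (Fin m) →L[ℝ] EuclideanSpace ℝ (Fin m) →L[ℝ] ℝ)) ∞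
      (fun x ↦ TotalSpace.mk' (EuclideanSpace ℝ (Fin m) →L[ℝ] EuclideanSpace ℝ (Fin m) →L[ℝ] ℝ)
        (E := fun x : M ↦ (TangentSpace (𝓡 m) x →L[ℝ] TangentSpace (𝓡 m) x →L[ℝ] ℝ)) x (β x))) :
    ∃ C : ℝ, 0 < C ∧ ∀ (x : M) (v w : TangentSpace (𝓡 m) x),
      |β x v w| ≤ C * (√(g.inner x v v) * √(g.inner x w w)) := by
  have hloc : ∀ x : M, ∃ C : ℝ, 0 < C ∧ ∀ᶠ y in 𝓝 x, ∀ (v w : TangentSpace (𝓡 m) y),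
      |β y v w| ≤ C * (√(g.inner y v v) * √(g.inner y w w)) := by
    intro x
    -- Norms on the fibres are taken from `g`, so that the local bound on the trivialization refers
    -- to `g`.
    let _ : RiemannianBundle (fun x : M ↦ TangentSpace (𝓡 m) x) :=
      ⟨g.toContinuousRiemannianMetric.toRiemannianMetric⟩
    obtain ⟨C, hC, hCe⟩ := eventually_norm_trivializationAt_lt (EuclideanSpace ℝ (Fin m))
      (fun y : M ↦ TangentSpace (𝓡 m) y) x
    have hb := ((contMDiffAt_hom_bundle _).1 (hβ x)).2.continuousAt
    simp only [TotalSpace.mk'] at hb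
    set e := trivializationAt (EuclideanSpace ℝ (Fin m)) (fun y : M ↦ TangentSpace (𝓡 m) y) x
      with he
    have hx : x ∈ e.baseSet := FiberBundle.mem_baseSet_trivializationAt' x
    set G := fun y ↦ ContinuousLinearMap.inCoordinates (EuclideanSpace ℝ (Fin m))
      (fun y : M ↦ TangentSpace (𝓡 m) y) (EuclideanSpace ℝ (Fin m) →L[ℝ] ℝ)
      (fun y : M ↦ (TangentSpace (𝓡 m) y →L[ℝ] ℝ)) x y x y (β y) with hG
    have hGa : ∀ y ∈ e.baseSet, ∀ v w, G y v w = β y (e.symm y v) (e.symm y w) := by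
      intro y hy v w
      simp only [hG]
      rw [inCoordinates_apply_eq₂ hy hy (Set.mem_univ _)]
      simp [he]
    have hbd : ∀ᶠ y in 𝓝 x, ‖G y‖ < ‖G x‖ + 1 :=
      hb.norm.eventually_lt continuousAt_const (by simp)
    refine ⟨(‖G x‖ + 1) * (C * C), by positivity, ?_⟩
    filter_upwards [hCe, hbd, e.open_baseSet.mem_nhds hx] with y h1 h2 h3 v w
    have hv : ∀ v : TangentSpace (𝓡 m) y, ‖(e ⟨y, v⟩).2‖ ≤ C * √(g.inner y v v) := by
      intro v
      have h4 := (e.continuousLinearMapAt ℝ y).le_opNorm v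
      have h5 : ‖v‖ = √(g.inner y v v) := norm_eq_sqrt_real_inner (F := TangentSpace (𝓡 m) y) v
      rw [h5] at h4
      have h6 : e.continuousLinearMapAt ℝ y v = (e ⟨y, v⟩).2 := by
        simp [e.coe_linearMapAt_of_mem h3]
      rw [h6] at h4
      exact h4.trans (by gcongr)
    have h7 : β y v w = G y (e ⟨y, v⟩).2 (e ⟨y, w⟩).2 := by
      rw [hGa y h3, e.symm_apply_apply_mk h3, e.symm_apply_apply_mk h3]
    rw [h7, ← Real.norm_eq_abs]
    calc ‖G y (e ⟨y, v⟩).2 (e ⟨y, w⟩).2‖ ≤ ‖G y‖ * ‖(e ⟨y, v⟩).2‖ * ‖(e ⟨y, w⟩).2‖ :=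
          (G y).le_opNorm₂ _ _
      _ ≤ (‖G x‖ + 1) * (C * √(g.inner y v v)) * (C * √(g.inner y w w)) := by
          gcongr
          exacts [hv v, hv w]
      _ = _ := by ring
  choose C hC hCe using hloc
  obtain ⟨t, ht⟩ := CompactSpace.elim_nhds_subcover (fun x ↦ {y | ∀ (v w : TangentSpace (𝓡 m) y),
      |β y v w| ≤ C x * (√(g.inner y v v) * √(g.inner y w w))}) hCe
  -- The sum dominates each local constant; the extra 1 keeps the bound positive when the cover is
  -- empty.
  refine ⟨∑ x ∈ t, C x + 1, by have := Finset.sum_nonneg (fun x (_ : x ∈ t) ↦ (hC x).le); linarith,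
    fun y v w ↦ ?_⟩
  obtain ⟨x, hxt, hx⟩ := Set.mem_iUnion₂.1 (ht.symm ▸ Set.mem_univ y :
    y ∈ ⋃ x ∈ t, {y | ∀ (v w : TangentSpace (𝓡 m) y),
      |β y v w| ≤ C x * (√(g.inner y v v) * √(g.inner y w w))})
  refine (hx v w).trans ?_
  gcongr
  have := Finset.single_le_sum (fun x (_ : x ∈ t) ↦ (hC x).le) hxt
  linarith

/-- A field of positive definite symmetric bilinear forms which is smooth on smooth vector fields
is a smooth Riemannian metric. -/
theorem exists_smoothMetric [T2Space M] (B : TwoTensor m M) (hB : ∀ x, IsBilinearMap ℝ (B x))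
    (hsymm : ∀ x v w, B x v w = B x w v) (hpos : ∀ x v, v ≠ 0 → 0 < B x v v)
    (hs : ∀ X Y : VField m M, SmoothVField X → SmoothVField Y →
      SmoothFun (m := m) (fun y ↦ B y (X y) (Y y))) :
    ∃ g : SmoothMetric m M, ∀ x v w, g.inner x v w = B x v w := by
  obtain ⟨β, hβ⟩ := exists_bilin B hB
  refine ⟨⟨β, fun x v w ↦ by simp only [hβ, hsymm x v w], fun x v hv ↦ by
    rw [hβ]; exact hpos x v hv, fun x ↦ ?_, contMDiff_bilin_of_apply (by simpa only [hβ] using hs)⟩,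
    hβ⟩
  -- The topology of the tangent space is that of the model space, where boundedness of the unit
  -- ball follows from positivity.
  exact isVonNBounded_of_pos (E := EuclideanSpace ℝ (Fin m)) (β x)
    fun v hv ↦ (hpos x v hv).trans_eq (hβ x v v).symm

end Bilinear

/-! ### Exterior derivatives of 1-forms -/

section Exterior

variable {m : ℕ} {M : Type*} [TopologicalSpace M] [ChartedSpace (EuclideanSpace ℝ (Fin m)) M]
  [IsManifold (𝓡 m) ∞ M]

variable {α η θ : OneForm m M} {X Y Z : VField m M} {J : EndField m M}

/-- The function `α(X)`. -/
noncomputable abbrev ev (α : OneForm m M) (X : VField m M) : M → ℝ := fun y ↦ α y (X y)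

/-- The vector field `JX`. -/
noncomputable abbrev app (J : EndField m M) (X : VField m M) : VField m M := fun y ↦ J y (X y)

omit [IsManifold (𝓡 m) ∞ M] in
@[simp]
theorem ev_apply (α : OneForm m M) (X : VField m M) (y : M) : ev α X y = α y (X y) := rfl

omit [IsManifold (𝓡 m) ∞ M] in
@[simp]
theorem app_apply (J : EndField m M) (X : VField m M) (y : M) : app J X y = J y (X y) := rfl

theorem dOneForm_fields (hα : SmoothOneForm α) (hX : SmoothVField X) (hY : SmoothVField Y)
    (x : M) : dOneForm α x (X x) (Y x)
      = der X (ev α Y) x - der Y (ev α X) x - α x (lie X Y x) :=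
  dOneForm_apply hα (hX.mdiffAt x) (hY.mdiffAt x)

theorem SmoothOneForm.smul (hα : SmoothOneForm α) (c : ℝ) : SmoothOneForm (c • α) :=
  ContMDiff.const_smul_section hα

theorem SmoothOneForm.add (hα : SmoothOneForm α) (hη : SmoothOneForm η) :
    SmoothOneForm (α + η) :=
  ContMDiff.add_section hα hη

theorem smoothFun_dOneForm (hα : SmoothOneForm α) (hX : SmoothVField X) (hY : SmoothVField Y) :
    SmoothFun (m := m) (fun y ↦ dOneForm α y (X y) (Y y)) := by
  simp only [dOneForm_fields hα hX hY]
  exact ((hX.der (hα.apply hY)).sub (hY.der (hα.apply hX))).sub (hα.apply (hX.lie hY))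

variable [T2Space M]

/-- Vectors are extended to smooth fields and scalars to constant functions; the invariant formula
is then additive and homogeneous, because derivatives of constants vanish. -/
theorem isBilinearMap_dOneForm (hα : SmoothOneForm α) (x : M) :
    IsBilinearMap ℝ (dOneForm α x) where
  add_left u v w := by
    obtain ⟨X, hX, rfl⟩ := exists_smoothVField_apply_eq x u
    obtain ⟨Y, hY, rfl⟩ := exists_smoothVField_apply_eq x v
    obtain ⟨Z, hZ, rfl⟩ := exists_smoothVField_apply_eq x w
    have h := dOneForm_fields hα (hX.add hY) hZ x
    have e : ev α (X + Y) = ev α X + ev α Y := by funext y; simp [ev_apply]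
    rw [e, der_add (hα.apply hX) (hα.apply hY), lie_add_left hX hY] at h
    have e2 : der (X + Y) (ev α Z) x = der X (ev α Z) x + der Y (ev α Z) x := by
      simp [der, dirDeriv]
    rw [e2] at h
    simp only [Pi.add_apply, map_add] at h
    rw [h, dOneForm_fields hα hX hZ, dOneForm_fields hα hY hZ]
    ring
  smul_left c u w := by
    obtain ⟨X, hX, rfl⟩ := exists_smoothVField_apply_eq x u
    obtain ⟨Z, hZ, rfl⟩ := exists_smoothVField_apply_eq x w
    have h := dOneForm_fields hα (hX.smul (f := fun _ ↦ c) contMDiff_const) hZ x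
    have e : ev α ((fun _ : M ↦ c) • X) = fun y ↦ c * ev α X y := by funext y; simp [ev_apply]
    rw [e, der_const_mul (hα.apply hX), lie_smul_left hX contMDiff_const, der_const] at h
    have e2 : der ((fun _ : M ↦ c) • X) (ev α Z) x = c * der X (ev α Z) x := by
      simp [der, dirDeriv]
    rw [e2] at h
    simp only [Pi.add_apply, Pi.smul_apply', Pi.zero_apply, zero_smul, neg_zero,
      zero_add, map_smul, smul_eq_mul] at h
    rw [h, dOneForm_fields hα hX hZ]
    simp only [smul_eq_mul]
    ring
  add_right w u v := by
    obtain ⟨X, hX, rfl⟩ := exists_smoothVField_apply_eq x u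
    obtain ⟨Y, hY, rfl⟩ := exists_smoothVField_apply_eq x v
    obtain ⟨Z, hZ, rfl⟩ := exists_smoothVField_apply_eq x w
    have h := dOneForm_fields hα hZ (hX.add hY) x
    have e : ev α (X + Y) = ev α X + ev α Y := by funext y; simp [ev_apply]
    rw [e, der_add (hα.apply hX) (hα.apply hY), lie_add_right hX hY] at h
    have e2 : der (X + Y) (ev α Z) x = der X (ev α Z) x + der Y (ev α Z) x := by
      simp [der, dirDeriv]
    rw [e2] at h
    simp only [Pi.add_apply, map_add] at h
    rw [h, dOneForm_fields hα hZ hX, dOneForm_fields hα hZ hY]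
    ring
  smul_right c w u := by
    obtain ⟨X, hX, rfl⟩ := exists_smoothVField_apply_eq x u
    obtain ⟨Z, hZ, rfl⟩ := exists_smoothVField_apply_eq x w
    have h := dOneForm_fields hα hZ (hX.smul (f := fun _ ↦ c) contMDiff_const) x
    have e : ev α ((fun _ : M ↦ c) • X) = fun y ↦ c * ev α X y := by funext y; simp [ev_apply]
    rw [e, der_const_mul (hα.apply hX), lie_smul_right hX contMDiff_const, der_const] at h
    have e2 : der ((fun _ : M ↦ c) • X) (ev α Z) x = c * der X (ev α Z) x := by
      simp [der, dirDeriv]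
    rw [e2] at h
    simp only [Pi.add_apply, Pi.smul_apply', Pi.zero_apply, zero_smul,
      zero_add, map_smul, smul_eq_mul] at h
    rw [h, dOneForm_fields hα hZ hX]
    simp only [smul_eq_mul]
    ring

omit [T2Space M] in
theorem dOneForm_swap (x : M) (v w : TangentSpace (𝓡 m) x) :
    dOneForm α x v w = -dOneForm α x w v :=
  dOneFormOn_swap ..

theorem dOneForm_add (hα : SmoothOneForm α) (hη : SmoothOneForm η) (x : M)
    (v w : TangentSpace (𝓡 m) x) :
    dOneForm (α + η) x v w = dOneForm α x v w + dOneForm η x v w := by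
  obtain ⟨X, hX, rfl⟩ := exists_smoothVField_apply_eq x v
  obtain ⟨Y, hY, rfl⟩ := exists_smoothVField_apply_eq x w
  rw [dOneForm_fields (hα.add hη) hX hY, dOneForm_fields hα hX hY, dOneForm_fields hη hX hY]
  have e (X : VField m M) : ev (α + η) X = ev α X + ev η X := by funext y; simp [ev_apply]
  rw [e, e, der_add (hα.apply hX) (hη.apply hX), der_add (hα.apply hY) (hη.apply hY)]
  simp only [Pi.add_apply, add_apply]
  ring

theorem dOneForm_smul (hα : SmoothOneForm α) (c : ℝ) (x : M) (v w : TangentSpace (𝓡 m) x) :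
    dOneForm (c • α) x v w = c * dOneForm α x v w := by
  obtain ⟨X, hX, rfl⟩ := exists_smoothVField_apply_eq x v
  obtain ⟨Y, hY, rfl⟩ := exists_smoothVField_apply_eq x w
  rw [dOneForm_fields (hα.smul c) hX hY, dOneForm_fields hα hX hY]
  have e (X : VField m M) : ev (c • α) X = fun y ↦ c * ev α X y := by funext y; simp [ev_apply]
  rw [e, e, der_const_mul (hα.apply hX), der_const_mul (hα.apply hY)]
  simp only [Pi.smul_apply, smul_apply, smul_eq_mul]
  ring

omit [IsManifold (𝓡 m) ∞ M] [T2Space M] in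
theorem dTwoFormOn_eq_der (β : TwoTensor m M) (x : M) :
    dTwoFormOn β X Y Z x = der X (fun y ↦ β y (Y y) (Z y)) x + der Y (fun y ↦ β y (Z y) (X y)) x
      + der Z (fun y ↦ β y (X y) (Y y)) x - β x (lie X Y x) (Z x) - β x (lie Y Z x) (X x)
      - β x (lie Z X x) (Y x) := rfl

/-- `d(dα) = 0` for a 1-form `α`. -/
theorem dTwoFormOn_dOneForm (hα : SmoothOneForm α) (hX : SmoothVField X) (hY : SmoothVField Y)
    (hZ : SmoothVField Z) (x : M) : dTwoFormOn (dOneForm α) X Y Z x = 0 := by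
  rw [dTwoFormOn_eq_der]
  have key : ∀ {X Y Z : VField m M}, SmoothVField X → SmoothVField Y → SmoothVField Z →
      der X (fun y ↦ dOneForm α y (Y y) (Z y)) x
        = der X (der Y (ev α Z)) x - der X (der Z (ev α Y)) x - der X (ev α (lie Y Z)) x := by
    intro X Y Z hX hY hZ
    have e : (fun y ↦ dOneForm α y (Y y) (Z y))
        = der Y (ev α Z) - der Z (ev α Y) - ev α (lie Y Z) := by
      funext y; exact dOneForm_fields hα hY hZ y
    rw [e, der_sub ((hY.der (hα.apply hZ)).sub (hZ.der (hα.apply hY))) (hα.apply (hY.lie hZ)),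
      der_sub (hY.der (hα.apply hZ)) (hZ.der (hα.apply hY))]
    rfl
  rw [key hX hY hZ, key hY hZ hX, key hZ hX hY, dOneForm_fields hα (hX.lie hY) hZ,
    dOneForm_fields hα (hY.lie hZ) hX, dOneForm_fields hα (hZ.lie hX) hY,
    der_lie hX hY (hα.apply hZ), der_lie hY hZ (hα.apply hX), der_lie hZ hX (hα.apply hY)]
  -- The cyclic form of the Jacobi identity; the second derivatives cancel by `der_lie`.
  have hj : α x (lie (lie X Y) Z x) + α x (lie (lie Y Z) X x) + α x (lie (lie Z X) Y x) = 0 := by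
    have h1 := lie_jacobi hX hY hZ
    rw [lie_swap (X := X) (Y := lie Y Z), lie_swap (X := Y) (Y := lie X Z),
      lie_swap (X := X) (Y := Z), lie_neg_left (hZ.lie hX)] at h1
    have h2 := congrArg (α x) (congrFun h1 x)
    simp only [Pi.add_apply, Pi.neg_apply, map_add, map_neg] at h2
    linarith
  simp only [Pi.sub_apply]
  linarith

/-- If `dθ = 0`, then `Ω = dη - θ ∧ η` satisfies `dΩ = θ ∧ Ω`. -/
theorem dTwoFormOn_eq_wedgeOneTwo {Ω : TwoTensor m M} (hθ : SmoothOneForm θ)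
    (hη : SmoothOneForm η) (hclosed : ∀ x v w, dOneForm θ x v w = 0)
    (hΩ : ∀ x v w, Ω x v w = dOneForm η x v w - (θ x v * η x w - θ x w * η x v))
    (hX : SmoothVField X) (hY : SmoothVField Y) (hZ : SmoothVField Z) (x : M) :
    dTwoFormOn Ω X Y Z x = wedgeOneTwo θ Ω x (X x) (Y x) (Z x) := by
  have hd := dTwoFormOn_dOneForm hη hX hY hZ x
  rw [dTwoFormOn_eq_der] at hd ⊢
  have key : ∀ {X Y Z : VField m M}, SmoothVField X → SmoothVField Y → SmoothVField Z →
      der X (fun y ↦ Ω y (Y y) (Z y)) x = der X (fun y ↦ dOneForm η y (Y y) (Z y)) x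
        - ((θ x (Y x) * der X (ev η Z) x + η x (Z x) * der X (ev θ Y) x)
          - (θ x (Z x) * der X (ev η Y) x + η x (Y x) * der X (ev θ Z) x)) := by
    intro X Y Z hX hY hZ
    have e : (fun y ↦ Ω y (Y y) (Z y)) = (fun y ↦ dOneForm η y (Y y) (Z y))
        - (ev θ Y * ev η Z - ev θ Z * ev η Y) := by
      funext y; exact hΩ y _ _
    rw [e, der_sub (smoothFun_dOneForm hη hY hZ)
      (((hθ.apply hY).mul (hη.apply hZ)).sub ((hθ.apply hZ).mul (hη.apply hY))),
      der_sub ((hθ.apply hY).mul (hη.apply hZ)) ((hθ.apply hZ).mul (hη.apply hY)),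
      der_mul (hθ.apply hY) (hη.apply hZ), der_mul (hθ.apply hZ) (hη.apply hY)]
    rfl
  -- The computation is `d(dη - θ ∧ η) = -dθ ∧ η + θ ∧ dη = θ ∧ dη = θ ∧ Ω`. The three instances of
  -- `dθ = 0` below enter with the values of `η` as coefficients.
  rw [key hX hY hZ, key hY hZ hX, key hZ hX hY]
  have c1 := dOneForm_fields hθ hX hY x
  have c2 := dOneForm_fields hθ hY hZ x
  have c3 := dOneForm_fields hθ hZ hX x
  rw [hclosed] at c1 c2 c3
  simp only [wedgeOneTwo, hΩ]
  rw [dOneForm_fields hη hX hY, dOneForm_fields hη hY hZ, dOneForm_fields hη hZ hX]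
  linear_combination hd + η x (Z x) * c1 + η x (X x) * c2 + η x (Y x) * c3

/-- The differential of a smooth function is a smooth 1-form. -/
theorem smoothOneForm_mvfderiv {φ : M → ℝ} (hφ : SmoothFun (m := m) φ) :
    SmoothOneForm (fun x ↦ mvfderiv (𝓡 m) φ x) :=
  .of_apply fun _ hX ↦ hX.der hφ

/-- `d(dφ) = 0` for a function `φ`. -/
theorem dOneForm_mvfderiv {φ : M → ℝ} (hφ : SmoothFun (m := m) φ) (x : M)
    (v w : TangentSpace (𝓡 m) x) : dOneForm (fun x ↦ mvfderiv (𝓡 m) φ x) x v w = 0 := by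
  obtain ⟨X, hX, rfl⟩ := exists_smoothVField_apply_eq x v
  obtain ⟨Y, hY, rfl⟩ := exists_smoothVField_apply_eq x w
  rw [dOneForm_fields (smoothOneForm_mvfderiv hφ) hX hY]
  have := congrFun (der_lie hX hY hφ) x
  rw [Pi.sub_apply] at this
  have e : der (lie X Y) φ x = mvfderiv (𝓡 m) φ x (lie X Y x) := rfl
  rw [← e, this]
  exact sub_self _

theorem SmoothOneForm.actOneForm (hα : SmoothOneForm α) (hJ : SmoothEndField J) :
    SmoothOneForm (actOneForm J α) :=
  .of_apply fun _ hX ↦ (hα.apply (hJ.apply hX)).neg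

/-- For a closed 1-form `α` on a complex manifold, `d(Jα)` is of type (1,1). -/
theorem isOneOne_dOneForm_actOneForm (hJ : IsComplexStructure J) (hα : SmoothOneForm α)
    (hclosed : ∀ x v w, dOneForm α x v w = 0) : IsOneOne J (dOneForm (actOneForm J α)) := by
  intro x v w
  obtain ⟨X, hX, rfl⟩ := exists_smoothVField_apply_eq x v
  obtain ⟨Y, hY, rfl⟩ := exists_smoothVField_apply_eq x w
  have hJX := hJ.smooth.apply hX
  have hJY := hJ.smooth.apply hY
  have h1 := dOneForm_fields (hα.actOneForm hJ.smooth) hX hY x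
  have h2 := dOneForm_fields (hα.actOneForm hJ.smooth) hJX hJY x
  have e1 (X : VField m M) : ev (actOneForm J α) X = -ev α (app J X) := by
    funext y; simp [ev_apply, actOneForm]
  have e2 (X : VField m M) : ev α (app J (app J X)) = -ev α X := by
    funext y; simp [ev_apply, hJ.sq]
  simp only [e1, e2, der_neg, neg_neg, Pi.neg_apply] at h1 h2
  rw [h1, h2]
  -- The difference `d(Jα)(JX,JY) - d(Jα)(X,Y)` equals `dα(X,JY) + dα(JX,Y) + α(J N(X,Y))`, and all
  -- three terms vanish.
  have c1 := dOneForm_fields hα hX hJY x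
  have c2 := dOneForm_fields hα hJX hY x
  rw [hclosed] at c1 c2
  have hN := congrArg (fun v ↦ α x (J x v)) (hJ.integrable X Y hX hY x)
  simp only [nijenhuis, hJ.sq, map_add, map_sub, map_neg, map_zero] at hN
  simp only [actOneForm, neg_apply, ContinuousLinearMap.comp_apply]
  linarith

end Exterior

/-! ### The Levi-Civita connection -/

section LeviCivita

variable {m : ℕ} {M : Type*} [TopologicalSpace M] [ChartedSpace (EuclideanSpace ℝ (Fin m)) M]
  [IsManifold (𝓡 m) ∞ M]

/-- Connections on the tangent bundle. -/
abbrev Connection (m : ℕ) (M : Type*) [TopologicalSpace M]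
    [ChartedSpace (EuclideanSpace ℝ (Fin m)) M] [IsManifold (𝓡 m) ∞ M] :=
  CovariantDerivative (𝓡 m) (EuclideanSpace ℝ (Fin m)) (fun x : M ↦ TangentSpace (𝓡 m) x)

variable {g g' : SmoothMetric m M} {D : Connection m M} {X Y Z : VField m M} {θ : OneForm m M}

theorem metric_ext (g : SmoothMetric m M) {x : M} {u v : TangentSpace (𝓡 m) x}
    (h : ∀ w, g.inner x u w = g.inner x v w) : u = v := by
  by_contra hne
  have h1 := g.pos x (u - v) (sub_ne_zero.2 hne)
  have h2 : g.inner x (u - v) (u - v) = g.inner x u (u - v) - g.inner x v (u - v) := by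
    rw [map_sub (g.inner x)]; rfl
  rw [h2, h, sub_self] at h1
  exact h1.false

theorem exists_inner_eq (g : SmoothMetric m M) {x : M} {l : TangentSpace (𝓡 m) x → ℝ}
    (hl : IsLinearMap ℝ l) : ∃ a : TangentSpace (𝓡 m) x, ∀ w, g.inner x a w = l w := by
  classical
  -- The functional at the single point `x` is extended by zero to a section of the cotangent
  -- bundle, since no regularity is required there.
  obtain ⟨a, ha⟩ := exists_sharp g
    (Function.update 0 x (LinearMap.toContinuousLinearMap (hl.mk' l))) x
  exact ⟨a, fun w ↦ by rw [ha, Function.update_self]; rfl⟩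

theorem mdifferentiableAt_inner (g : SmoothMetric m M) {x : M}
    (hX : MDifferentiableAt (𝓡 m) (𝓡 m).tangent (fun y ↦ (X y : TangentBundle (𝓡 m) M)) x)
    (hY : MDifferentiableAt (𝓡 m) (𝓡 m).tangent (fun y ↦ (Y y : TangentBundle (𝓡 m) M)) x) :
    MDifferentiableAt (𝓡 m) 𝓘(ℝ, ℝ) (fun y ↦ g.inner y (X y) (Y y)) x := by
  have h : MDifferentiableAt (𝓡 m) ((𝓡 m).prod 𝓘(ℝ, ℝ))
      (fun y ↦ TotalSpace.mk' ℝ (E := Bundle.Trivial M ℝ) y (g.inner y (X y) (Y y))) x :=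
    MDifferentiableAt.clm_bundle_apply₂ (F₁ := EuclideanSpace ℝ (Fin m))
      (F₂ := EuclideanSpace ℝ (Fin m))
      (E₁ := fun y : M ↦ TangentSpace (𝓡 m) y) (E₂ := fun y : M ↦ TangentSpace (𝓡 m) y)
      (g.contMDiff.mdifferentiableAt (by simp)) hX hY
  simp only [mdifferentiableAt_totalSpace] at h
  exact h.2

/-- The covariant derivative `v ↦ (∇_v g)(Y, Z)` of a metric with respect to a connection. -/
noncomputable def covDerivMetric (D : Connection m M) (g : SmoothMetric m M) (Y Z : VField m M)
    (x : M) : TangentSpace (𝓡 m) x →L[ℝ] ℝ :=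
  mvfderiv (𝓡 m) (fun y ↦ g.inner y (Y y) (Z y)) x - (g.inner x (Z x)).comp (D Y x)
    - (g.inner x (Y x)).comp (D Z x)

theorem covDerivMetric_swap (x : M) : covDerivMetric D g Y Z x = covDerivMetric D g Z Y x := by
  simp only [covDerivMetric, g.symm _ (Y _) (Z _)]
  abel

/-- The Leibniz term from differentiating `g(Y, fZ)` cancels the one coming from `D (fZ)`. -/
theorem tensorialAt_covDerivMetric {x : M}
    (hY : MDifferentiableAt (𝓡 m) (𝓡 m).tangent (fun y ↦ (Y y : TangentBundle (𝓡 m) M)) x) :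
    TensorialAt (𝓡 m) (EuclideanSpace ℝ (Fin m)) (fun Z ↦ covDerivMetric D g Y Z x) x where
  smul {f Z} hf hZ := by
    have h1 := mdifferentiableAt_inner g hY hZ
    have h2 : (fun y ↦ g.inner y (Y y) ((f • Z) y)) = fun y ↦ f y * g.inner y (Y y) (Z y) := by
      funext y; simp
    ext v
    simp only [covDerivMetric]
    rw [h2, mvfderiv_fun_mul hf h1, D.isCovariantDerivativeOn.leibniz hZ hf]
    simp
    ring
  add {Z W} hZ hW := by
    have h2 : (fun y ↦ g.inner y (Y y) ((Z + W) y))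
        = fun y ↦ g.inner y (Y y) (Z y) + g.inner y (Y y) (W y) := by
      funext y; simp
    ext v
    simp only [covDerivMetric]
    rw [h2, mvfderiv_fun_add (mdifferentiableAt_inner g hY hZ) (mdifferentiableAt_inner g hY hW),
      D.isCovariantDerivativeOn.add hZ hW]
    simp
    ring

theorem tensorialAt_covDerivMetric_right {x : M} (w : TangentSpace (𝓡 m) x)
    (hY : MDifferentiableAt (𝓡 m) (𝓡 m).tangent (fun y ↦ (Y y : TangentBundle (𝓡 m) M)) x) :
    TensorialAt (𝓡 m) (EuclideanSpace ℝ (Fin m)) (fun Z ↦ covDerivMetric D g Y Z x w) x where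
  smul hf hσ := congrArg (fun l ↦ l w) ((tensorialAt_covDerivMetric hY).smul hf hσ)
  add hσ hσ' := congrArg (fun l ↦ l w) ((tensorialAt_covDerivMetric hY).add hσ hσ')

theorem tensorialAt_covDerivMetric_left {x : M} (w : TangentSpace (𝓡 m) x)
    (hY : MDifferentiableAt (𝓡 m) (𝓡 m).tangent (fun y ↦ (Y y : TangentBundle (𝓡 m) M)) x) :
    TensorialAt (𝓡 m) (EuclideanSpace ℝ (Fin m)) (fun Z ↦ covDerivMetric D g Z Y x w) x := by
  simp only [covDerivMetric_swap (Z := Y)]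
  exact tensorialAt_covDerivMetric_right w hY

/-- The covariant derivative of a metric as a tensor. -/
noncomputable def covDerivMetricTensor (D : Connection m M) (g : SmoothMetric m M) (x : M)
    (w : TangentSpace (𝓡 m) x) : TangentSpace (𝓡 m) x →L[ℝ] TangentSpace (𝓡 m) x →L[ℝ] ℝ :=
  TensorialAt.mkHom₂ (fun Y Z ↦ covDerivMetric D g Y Z x w) x
    (fun _ ↦ tensorialAt_covDerivMetric_left w) (fun _ ↦ tensorialAt_covDerivMetric_right w)

theorem covDerivMetricTensor_eq_extend (x : M) (u v w : TangentSpace (𝓡 m) x) :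
    covDerivMetricTensor D g x w u v = covDerivMetric D g
      (FiberBundle.extend (EuclideanSpace ℝ (Fin m)) u)
      (FiberBundle.extend (EuclideanSpace ℝ (Fin m)) v) x w :=
  TensorialAt.mkHom₂_apply_eq_extend ..

theorem covDerivMetricTensor_apply (hY : SmoothVField Y) (hZ : SmoothVField Z) (x : M)
    (w : TangentSpace (𝓡 m) x) :
    covDerivMetricTensor D g x w (Y x) (Z x) = covDerivMetric D g Y Z x w :=
  TensorialAt.mkHom₂_apply _ _ (hY.mdiffAt x) (hZ.mdiffAt x)

/-- The properties of `Q(u,v,w) = (∇_w g)(u,v)` that the construction of a Levi-Civita connection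
uses: multilinearity and symmetry in the first two arguments. -/
theorem exists_covDerivMetric_tensor (D : Connection m M) (g : SmoothMetric m M) :
    ∃ Q : (x : M) → TangentSpace (𝓡 m) x → TangentSpace (𝓡 m) x → TangentSpace (𝓡 m) x → ℝ,
      (∀ x w, IsBilinearMap ℝ (fun u v ↦ Q x u v w)) ∧ (∀ x u v, IsLinearMap ℝ (Q x u v)) ∧
      (∀ x u v w, Q x u v w = Q x v u w) ∧
      ∀ Y Z : VField m M, SmoothVField Y → SmoothVField Z → ∀ x w,
        Q x (Y x) (Z x) w = covDerivMetric D g Y Z x w := by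
  refine ⟨fun x u v w ↦ covDerivMetricTensor D g x w u v, fun x w ↦ ?_, fun x u v ↦ ?_,
    fun x u v w ↦ ?_, fun Y Z hY hZ x w ↦ covDerivMetricTensor_apply hY hZ x w⟩
  · exact ⟨fun u v z ↦ by beta_reduce; rw [map_add, add_apply],
      fun c u v ↦ by beta_reduce; rw [map_smul, smul_apply],
      fun u v z ↦ map_add _ _ _, fun c u v ↦ map_smul _ _ _⟩
  · simp only [covDerivMetricTensor_eq_extend]
    exact ⟨map_add _, map_smul _⟩
  · simp only [covDerivMetricTensor_eq_extend]
    rw [covDerivMetric_swap]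

/-- If some smooth metric has a Levi-Civita connection, then every smooth metric has one. -/
theorem exists_isLeviCivita (hD : IsLeviCivita g D) (g' : SmoothMetric m M) :
    ∃ D' : Connection m M, IsLeviCivita g' D' := by
  obtain ⟨Q, hQb, hQl, hQs, hQ⟩ := exists_covDerivMetric_tensor D g'
  -- The new connection is `D + A`, with `A` given by a Koszul-type formula. `A` is symmetric in
  -- `y`, `v`, so the torsion stays zero, and `g'(A(y,v),z) + g'(y,A(z,v)) = Q(y,z,v)`, which
  -- cancels the defect of metricity of `D`.
  have hA : ∀ (x : M) (y v : TangentSpace (𝓡 m) x), ∃ a : TangentSpace (𝓡 m) x, ∀ z,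
      g'.inner x a z = (1 / 2) * (Q x y z v + Q x v z y - Q x v y z) := by
    intro x y v
    refine exists_inner_eq g' ⟨fun z z' ↦ ?_, fun c z ↦ ?_⟩
    · rw [(hQb x v).add_right, (hQb x y).add_right, (hQl x v y).map_add]
      ring
    · rw [(hQb x v).smul_right, (hQb x y).smul_right, (hQl x v y).map_smul]
      simp only [smul_eq_mul]
      ring
  choose A hA using hA
  have hbil : ∀ x, IsBilinearMap ℝ (A x) := by
    intro x
    constructor
    · intro y y' v
      apply metric_ext g'
      intro z
      rw [map_add, add_apply, hA, hA, hA, (hQb x v).add_left, (hQb x z).add_right,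
        (hQl x v z).map_add]
      ring
    · intro c y v
      apply metric_ext g'
      intro z
      rw [map_smul, smul_apply, hA, hA, (hQb x v).smul_left, (hQb x z).smul_right,
        (hQl x v z).map_smul]
      simp only [smul_eq_mul]
      ring
    · intro y v v'
      apply metric_ext g'
      intro z
      rw [map_add, add_apply, hA, hA, hA, (hQb x y).add_left, (hQb x z).add_left,
        (hQl x y z).map_add]
      ring
    · intro c y v
      apply metric_ext g'
      intro z
      rw [map_smul, smul_apply, hA, hA, (hQb x y).smul_left, (hQb x z).smul_left,
        (hQl x y z).map_smul]
      simp only [smul_eq_mul]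
      ring
  have hsymm : ∀ x y v, A x y v = A x v y := by
    intro x y v
    apply metric_ext g'
    intro z
    rw [hA, hA, hQs x y v]
    ring
  let D' : Connection m M :=
    ⟨_, D.isCovariantDerivativeOn.add_one_form fun x ↦ (hbil x).toContinuousBilinearMap⟩
  have hD' : ∀ (Y : VField m M) (x : M) (v : TangentSpace (𝓡 m) x),
      D' Y x v = D Y x v + A x (Y x) v := fun _ _ _ ↦ rfl
  refine ⟨D', ⟨?_, ?_⟩⟩
  · rw [CovariantDerivative.torsion_eq_zero_iff]
    intro X Y x hX hY
    have := (CovariantDerivative.torsion_eq_zero_iff D).1 hD.torsion_eq_zero hX hY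
    rw [hD', hD', ← this, hsymm x (Y x) (X x)]
    abel
  · intro Y Z hY hZ x v
    have h1 := hQ Y Z hY hZ x v
    simp only [covDerivMetric, sub_apply, ContinuousLinearMap.comp_apply] at h1
    rw [hD', hD', map_add, map_add, add_apply, g'.symm x (Y x) (A x (Z x) v),
      g'.symm x (D Y x v) (Z x)]
    have h2 := hA x (Y x) v (Z x)
    have h3 := hA x (Z x) v (Y x)
    rw [hQs x (Z x) (Y x)] at h3
    have h4 : dirDeriv (fun y ↦ g'.inner y (Y y) (Z y)) x v
      = mvfderiv (𝓡 m) (fun y ↦ g'.inner y (Y y) (Z y)) x v := rfl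
    rw [h4]
    linarith

theorem IsLeviCivita.torsion_free (hD : IsLeviCivita g D) (hX : SmoothVField X)
    (hY : SmoothVField Y) (x : M) : D Y x (X x) - D X x (Y x) = lie X Y x :=
  (CovariantDerivative.torsion_eq_zero_iff D).1 hD.torsion_eq_zero (hX.mdiffAt x) (hY.mdiffAt x)

theorem IsLeviCivita.der_inner (hD : IsLeviCivita g D) (hX : SmoothVField X)
    (hY : SmoothVField Y) (Z : VField m M) (x : M) :
    der Z (fun y ↦ g.inner y (X y) (Y y)) x
      = g.inner x (D X x (Z x)) (Y x) + g.inner x (X x) (D Y x (Z x)) :=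
  hD.metric X Y hX hY x (Z x)

/-- `X` preserves the metric: `X(g(Y, Z)) = g([X, Y], Z) + g(Y, [X, Z])`. -/
def IsKilling (g : SmoothMetric m M) (X : VField m M) : Prop :=
  ∀ Y Z : VField m M, SmoothVField Y → SmoothVField Z → ∀ x,
    der X (fun y ↦ g.inner y (Y y) (Z y)) x
      = g.inner x (lie X Y x) (Z x) + g.inner x (Y x) (lie X Z x)

variable [T2Space M]

/-- A closed 1-form whose dual vector field is Killing is parallel. -/
theorem isParallel_of_isKilling (hD : IsLeviCivita g D) (hθ : SmoothOneForm θ)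
    (hclosed : ∀ x v w, dOneForm θ x v w = 0) (hK : IsKilling g (sharp g θ)) :
    IsParallel g θ := by
  refine ⟨D, hD, fun Y hY x v ↦ ?_⟩
  obtain ⟨X, hX, rfl⟩ := exists_smoothVField_apply_eq x v
  have hU := smoothVField_sharp g hθ
  set U := sharp g θ with hUdef
  have he : ∀ Y : VField m M, ev θ Y = fun y ↦ g.inner y (U y) (Y y) := fun Y ↦ by
    funext y; exact (sharp_spec g θ y (Y y)).symm
  -- Closedness makes `g(∇_X U, Y)` symmetric in `X` and `Y`, while the Killing equation makes it
  -- skew. Hence it vanishes, and it equals `(∇_X θ)(Y)`.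
  have h1 := dOneForm_fields hθ hX hY x
  rw [hclosed, he, he, hD.der_inner hU hY, hD.der_inner hU hX, ← sharp_spec g θ, ← hUdef,
    ← hD.torsion_free hX hY, map_sub] at h1
  have h2 := hK X Y hX hY x
  rw [hD.der_inner hX hY, ← hD.torsion_free hU hX, ← hD.torsion_free hU hY, map_sub, map_sub,
    sub_apply] at h2
  have h3 : dirDeriv (fun y ↦ θ y (Y y)) x (X x) = der X (ev θ Y) x := rfl
  rw [h3, he, hD.der_inner hU hY, ← sharp_spec g θ, ← hUdef]
  have h4 := g.symm x (X x) (D U x (Y x))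
  linarith

/-- For a torsion-free connection, `dθ` is the antisymmetrization of `∇θ`. -/
theorem IsParallel.dOneForm_eq_zero (h : IsParallel g θ) (hθ : SmoothOneForm θ) (x : M)
    (v w : TangentSpace (𝓡 m) x) : dOneForm θ x v w = 0 := by
  obtain ⟨D, hD, hp⟩ := h
  obtain ⟨X, hX, rfl⟩ := exists_smoothVField_apply_eq x v
  obtain ⟨Y, hY, rfl⟩ := exists_smoothVField_apply_eq x w
  rw [dOneForm_fields hθ hX hY, ← hD.torsion_free hX hY, map_sub]
  have h1 : der X (ev θ Y) x - θ x (D Y x (X x)) = 0 := hp Y hY x (X x)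
  have h2 : der Y (ev θ X) x - θ x (D X x (Y x)) = 0 := hp X hX x (Y x)
  linarith

/-- The vector field dual to a parallel 1-form is Killing. -/
theorem IsParallel.isKilling (h : IsParallel g θ) (hθ : SmoothOneForm θ) :
    IsKilling g (sharp g θ) := by
  obtain ⟨D, hD, hp⟩ := h
  have hU := smoothVField_sharp g hθ
  -- For a metric connection `g(∇_v U, Y) = (∇_v θ)(Y)`, so `U` is parallel as well.
  have hDU : ∀ x v, D (sharp g θ) x v = 0 := by
    intro x v
    apply metric_ext g
    intro w
    obtain ⟨Y, hY, rfl⟩ := exists_smoothVField_apply_eq x w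
    have h1 := hp Y hY x v
    have h2 := hD.metric (sharp g θ) Y hU hY x v
    simp only [sharp_spec] at h2
    simp only [map_zero, zero_apply]
    linarith
  intro Y Z hY hZ x
  rw [hD.der_inner hY hZ, ← hD.torsion_free hU hY, ← hD.torsion_free hU hZ, hDU, hDU, sub_zero,
    sub_zero]

end LeviCivita

/-! ### The canonical foliation of a Vaisman manifold -/

section Vaisman

variable {m : ℕ} {M : Type*} [TopologicalSpace M] [ChartedSpace (EuclideanSpace ℝ (Fin m)) M]
  [IsManifold (𝓡 m) ∞ M]

variable {J : EndField m M} {g : SmoothMetric m M} {θ ζ : OneForm m M} {X Y Z : VField m M}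

theorem inner_leeField (g : SmoothMetric m M) (θ : OneForm m M) (x : M)
    (w : TangentSpace (𝓡 m) x) : g.inner x (leeField g θ x) w = θ x w := sharp_spec ..

theorem inner_antiLeeField (J : EndField m M) (g : SmoothMetric m M) (θ : OneForm m M) (x : M)
    (w : TangentSpace (𝓡 m) x) : g.inner x (antiLeeField J g θ x) w = antiLee J θ x w :=
  sharp_spec ..

omit [IsManifold (𝓡 m) ∞ M] in
theorem antiLee_apply (J : EndField m M) (θ : OneForm m M) (x : M) (v : TangentSpace (𝓡 m) x) :
    antiLee J θ x v = -θ x (J x v) := rfl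

theorem fundForm_leeField_left (x : M) (v : TangentSpace (𝓡 m) x) :
    fundForm J g x (leeField g θ x) v = -antiLee J θ x v := by
  rw [fundForm, inner_leeField, antiLee_apply, neg_neg]

namespace IsVaisman

variable (hV : IsVaisman J g θ)
include hV

theorem antiLee_app (x : M) (v : TangentSpace (𝓡 m) x) : antiLee J θ x (J x v) = θ x v := by
  rw [antiLee_apply, hV.complex.sq, map_neg, neg_neg]

theorem inner_app_left (x : M) (v w : TangentSpace (𝓡 m) x) :
    g.inner x (J x v) w = -g.inner x v (J x w) := by
  rw [← hV.hermitian x v (J x w), hV.complex.sq, map_neg, neg_neg]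

theorem app_leeField (x : M) : J x (leeField g θ x) = antiLeeField J g θ x := by
  apply metric_ext g
  intro w
  rw [hV.inner_app_left, inner_leeField, inner_antiLeeField, antiLee_apply]

theorem app_antiLeeField (x : M) : J x (antiLeeField J g θ x) = -leeField g θ x := by
  rw [← hV.app_leeField, hV.complex.sq]

theorem theta_leeField (x : M) : θ x (leeField g θ x) = 1 := by
  rw [← inner_leeField g]
  exact hV.unit x

theorem antiLee_leeField (x : M) : antiLee J θ x (leeField g θ x) = 0 := by
  have h1 := inner_antiLeeField J g θ x (leeField g θ x)
  have h2 := hV.inner_app_left x (leeField g θ x) (leeField g θ x)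
  rw [g.symm x (leeField g θ x), hV.app_leeField] at h2
  linarith

theorem theta_antiLeeField (x : M) : θ x (antiLeeField J g θ x) = 0 := by
  rw [← hV.app_leeField]
  simpa [antiLee_apply] using hV.antiLee_leeField x

theorem antiLee_antiLeeField (x : M) : antiLee J θ x (antiLeeField J g θ x) = 1 := by
  rw [← hV.app_leeField, hV.antiLee_app, hV.theta_leeField]

theorem fundForm_leeField_right (x : M) (v : TangentSpace (𝓡 m) x) :
    fundForm J g x v (leeField g θ x) = antiLee J θ x v := by
  rw [fundForm, hV.app_leeField, g.symm, inner_antiLeeField]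

variable [T2Space M]

theorem smoothOneForm_antiLee : SmoothOneForm (antiLee J θ) :=
  hV.smooth.actOneForm hV.complex.smooth

omit [T2Space M] in
theorem smoothVField_leeField : SmoothVField (leeField g θ) := smoothVField_sharp g hV.smooth

theorem smoothVField_antiLeeField : SmoothVField (antiLeeField J g θ) :=
  smoothVField_sharp g hV.smoothOneForm_antiLee

theorem dOneForm_theta (x : M) (v w : TangentSpace (𝓡 m) x) : dOneForm θ x v w = 0 :=
  hV.parallel.dOneForm_eq_zero hV.smooth x v w

theorem isOneOne_dOneForm_antiLee : IsOneOne J (dOneForm (antiLee J θ)) :=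
  isOneOne_dOneForm_actOneForm hV.complex hV.smooth hV.dOneForm_theta

theorem isKilling_leeField : IsKilling g (leeField g θ) := hV.parallel.isKilling hV.smooth

/-- Cartan's formula for `L_U ω`, with `ι_U ω = -θ^c` and `ι_U(θ ∧ ω) = ω + θ ∧ θ^c`. As `U` is
Killing, `L_U ω` reduces to `g(Y, (L_U J)Z)`. -/
theorem inner_lie_leeField (hY : SmoothVField Y) (hZ : SmoothVField Z) (x : M) :
    g.inner x (Y x) (lie (leeField g θ) (app J Z) x - J x (lie (leeField g θ) Z x))
      + dOneForm (antiLee J θ) x (Y x) (Z x)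
      = fundForm J g x (Y x) (Z x) + θ x (Y x) * antiLee J θ x (Z x)
        - θ x (Z x) * antiLee J θ x (Y x) := by
  have hU := hV.smoothVField_leeField
  have h1 := hV.lee _ Y Z hU hY hZ x
  rw [dTwoFormOn_eq_der, wedgeOneTwo] at h1
  have hc := dOneForm_fields hV.smoothOneForm_antiLee hY hZ x
  have e1 : (fun y ↦ fundForm J g y (Z y) (leeField g θ y)) = ev (antiLee J θ) Z := by
    funext y; exact hV.fundForm_leeField_right y _
  have e2 : (fun y ↦ fundForm J g y (leeField g θ y) (Y y)) = -ev (antiLee J θ) Y := by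
    funext y; exact fundForm_leeField_left y _
  have hk : der (leeField g θ) (fun y ↦ fundForm J g y (Y y) (Z y)) x = _ :=
    hV.isKilling_leeField Y (app J Z) hY (hV.complex.smooth.apply hZ) x
  rw [e1, e2, der_neg, hV.fundForm_leeField_right, hV.fundForm_leeField_right,
    fundForm_leeField_left, hV.theta_leeField, hk, lie_swap (X := Z)] at h1
  have h3 := hV.inner_app_left x (lie (leeField g θ) Z x) (Y x)
  rw [g.symm] at h3
  simp only [fundForm, Pi.neg_apply, map_neg, neg_apply, map_sub, app_apply] at h1 ⊢
  linarith

/-- The Lee field is holomorphic. -/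
theorem lie_leeField_app (hZ : SmoothVField Z) (x : M) :
    lie (leeField g θ) (app J Z) x = J x (lie (leeField g θ) Z x) := by
  rw [← sub_eq_zero]
  apply metric_ext g
  intro w
  obtain ⟨Y, hY, rfl⟩ := exists_smoothVField_apply_eq x w
  have hJY := hV.complex.smooth.apply hY
  have hJZ := hV.complex.smooth.apply hZ
  -- The identity is compared at `(Y,Z)` and `(JY,JZ)`. Since `L_U J` anticommutes with `J`, the
  -- term `g(Y, (L_U J)Z)` changes sign; every other term is `J`-invariant.
  have h1 := hV.inner_lie_leeField hY hZ x
  have h2 := hV.inner_lie_leeField hJY hJZ x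
  have e : app J (app J Z) = -Z := by funext y; exact hV.complex.sq y _
  rw [e, lie_neg_right hZ, hV.isOneOne_dOneForm_antiLee, hV.antiLee_app, hV.antiLee_app] at h2
  simp only [fundForm, hV.hermitian] at h1 h2
  have h3 := antiLee_apply J θ x (Y x)
  have h4 := antiLee_apply J θ x (Z x)
  have h5 := hV.inner_app_left x (Y x) (lie (leeField g θ) Z x)
  simp only [Pi.neg_apply, map_sub, map_neg, hV.hermitian] at h1 h2
  rw [g.symm, map_zero, zero_apply, map_sub]
  rw [h3, h4] at h1
  linarith

/-- With `L_U J = 0`, the Cartan identity becomes `ω = dθ^c - θ ∧ θ^c`. -/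
theorem dOneForm_antiLee (x : M) (v w : TangentSpace (𝓡 m) x) :
    dOneForm (antiLee J θ) x v w
      = fundForm J g x v w + θ x v * antiLee J θ x w - θ x w * antiLee J θ x v := by
  obtain ⟨Y, hY, rfl⟩ := exists_smoothVField_apply_eq x v
  obtain ⟨Z, hZ, rfl⟩ := exists_smoothVField_apply_eq x w
  have h1 := hV.inner_lie_leeField hY hZ x
  rw [hV.lie_leeField_app hZ, sub_self, map_zero] at h1
  linarith

/-- This presentation of the metric by `J`, `θ` and `θ^c` alone is the one that persists under
deformation. -/
theorem inner_eq (x : M) (v w : TangentSpace (𝓡 m) x) :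
    g.inner x v w = dOneForm (antiLee J θ) x (J x v) w + θ x v * θ x w
      + antiLee J θ x v * antiLee J θ x w := by
  have h := antiLee_apply J θ x v
  rw [hV.dOneForm_antiLee, fundForm, hV.hermitian, hV.antiLee_app]
  rw [h]
  ring

/-- The anti-Lee field is holomorphic. -/
theorem lie_antiLeeField_app (hZ : SmoothVField Z) (x : M) :
    lie (antiLeeField J g θ) (app J Z) x = J x (lie (antiLeeField J g θ) Z x) := by
  -- In `N(U,Z) = 0` the first and third terms cancel because `U` is holomorphic; since `JU = V`,
  -- what is left is the claim.
  have h := hV.complex.integrable _ Z hV.smoothVField_leeField hZ x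
  have h2 := hV.lie_leeField_app hZ x
  simp only [nijenhuis, hV.app_leeField] at h
  rw [show mlieBracket (𝓡 m) (leeField g θ) (fun y ↦ J y (Z y)) x = _ from h2, sub_right_comm,
    sub_self, zero_sub, neg_add_eq_zero] at h
  exact h.symm

theorem lie_leeField_antiLeeField (x : M) : lie (leeField g θ) (antiLeeField J g θ) x = 0 := by
  have h := hV.lie_leeField_app hV.smoothVField_leeField x
  have e : app J (leeField g θ) = antiLeeField J g θ := funext hV.app_leeField
  rw [e] at h
  rw [h, show lie (leeField g θ) (leeField g θ) x = 0 from congrFun mlieBracket_self x, map_zero]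

/-- The form `θ` is invariant under leafwise translations. -/
theorem der_leeField_theta (hY : SmoothVField Y) (x : M) :
    der (leeField g θ) (ev θ Y) x = θ x (lie (leeField g θ) Y x) := by
  have h := dOneForm_fields hV.smooth hV.smoothVField_leeField hY x
  have e : ev θ (leeField g θ) = fun _ ↦ 1 := funext hV.theta_leeField
  rw [hV.dOneForm_theta, e, der_const, Pi.zero_apply] at h
  linarith

theorem der_leeField_antiLee (hY : SmoothVField Y) (x : M) :
    der (leeField g θ) (ev (antiLee J θ) Y) x = antiLee J θ x (lie (leeField g θ) Y x) := by
  have h := hV.der_leeField_theta (hV.complex.smooth.apply hY) x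
  have e : ev (antiLee J θ) Y = -ev θ (app J Y) := rfl
  rw [e, der_neg, Pi.neg_apply, antiLee_apply, ← hV.lie_leeField_app hY, h]

end IsVaisman

end Vaisman

/-! ### Basic functions and basic 1-forms -/

section Basic

variable {m : ℕ} {M : Type*} [TopologicalSpace M] [ChartedSpace (EuclideanSpace ℝ (Fin m)) M]
  [IsManifold (𝓡 m) ∞ M] [T2Space M]

variable {J : EndField m M} {g : SmoothMetric m M} {θ ζ : OneForm m M} {X Y Z : VField m M}
  {φ : M → ℝ}

omit [T2Space M] in
theorem IsVaisman.isLeafwise_leeField (hV : IsVaisman J g θ) :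
    IsLeafwise J g θ (leeField g θ) :=
  ⟨hV.smoothVField_leeField, fun _ ↦ Submodule.subset_span (by simp)⟩

theorem IsVaisman.isLeafwise_antiLeeField (hV : IsVaisman J g θ) :
    IsLeafwise J g θ (antiLeeField J g θ) :=
  ⟨hV.smoothVField_antiLeeField, fun _ ↦ Submodule.subset_span (by simp)⟩

omit [T2Space M] in
-- Cartan's formula, in which the term `d(ζ(X))` vanishes.
theorem lieDerivOneForm_eq_dOneForm (hζ : SmoothOneForm ζ) (hX : SmoothVField X)
    (hY : SmoothVField Y) (hζX : ∀ x, ζ x (X x) = 0) (x : M) :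
    lieDerivOneForm X ζ Y x = dOneForm ζ x (X x) (Y x) := by
  have e : ev ζ X = fun _ ↦ 0 := funext hζX
  rw [dOneForm_fields hζ hX hY, e, der_const, Pi.zero_apply, sub_zero]
  rfl

/-- Once `ζ` vanishes on the leaves, `Lie_X ζ = ι_X dζ` is tensorial in `X`, so the generators `U`
and `V` suffice. -/
theorem isBasicOneForm_of_dOneForm (hζ : SmoothOneForm ζ)
    (hU : ∀ x, ζ x (leeField g θ x) = 0) (hV : ∀ x, ζ x (antiLeeField J g θ x) = 0)
    (hdU : ∀ x v, dOneForm ζ x (leeField g θ x) v = 0)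
    (hdV : ∀ x v, dOneForm ζ x (antiLeeField J g θ x) v = 0) : IsBasicOneForm J g θ ζ := by
  refine ⟨hζ, fun X hX ↦ ?_⟩
  have h0 : ∀ x, ζ x (X x) = 0 := fun x ↦ by
    obtain ⟨a, b, hab⟩ := Submodule.mem_span_pair.1 (hX.2 x)
    rw [← hab, map_add, map_smul, map_smul, hU, hV, smul_zero, smul_zero, add_zero]
  refine ⟨h0, fun Y hY x ↦ ?_⟩
  rw [lieDerivOneForm_eq_dOneForm hζ hX.1 hY h0]
  obtain ⟨a, b, hab⟩ := Submodule.mem_span_pair.1 (hX.2 x)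
  have hB := isBilinearMap_dOneForm hζ x
  rw [← hab, hB.add_left, hB.smul_left, hB.smul_left, hdU, hdV, smul_zero, smul_zero, add_zero]

namespace IsBasicOneForm

variable (hζ : IsBasicOneForm J g θ ζ) (hV : IsVaisman J g θ)
include hζ hV

omit [T2Space M] in
theorem apply_leeField (x : M) : ζ x (leeField g θ x) = 0 :=
  (hζ.2 _ hV.isLeafwise_leeField).1 x

theorem apply_antiLeeField (x : M) : ζ x (antiLeeField J g θ x) = 0 :=
  (hζ.2 _ hV.isLeafwise_antiLeeField).1 x

theorem dOneForm_leeField (x : M) (v : TangentSpace (𝓡 m) x) :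
    dOneForm ζ x (leeField g θ x) v = 0 := by
  obtain ⟨Y, hY, rfl⟩ := exists_smoothVField_apply_eq x v
  rw [← lieDerivOneForm_eq_dOneForm hζ.1 hV.smoothVField_leeField hY (hζ.apply_leeField hV)]
  exact (hζ.2 _ hV.isLeafwise_leeField).2 Y hY x

theorem dOneForm_antiLeeField (x : M) (v : TangentSpace (𝓡 m) x) :
    dOneForm ζ x (antiLeeField J g θ x) v = 0 := by
  obtain ⟨Y, hY, rfl⟩ := exists_smoothVField_apply_eq x v
  rw [← lieDerivOneForm_eq_dOneForm hζ.1 hV.smoothVField_antiLeeField hY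
    (hζ.apply_antiLeeField hV)]
  exact (hζ.2 _ hV.isLeafwise_antiLeeField).2 Y hY x

omit [T2Space M] in
theorem der_leeField (hY : SmoothVField Y) (x : M) :
    der (leeField g θ) (ev ζ Y) x = ζ x (lie (leeField g θ) Y x) :=
  sub_eq_zero.1 ((hζ.2 _ hV.isLeafwise_leeField).2 Y hY x)

theorem der_antiLeeField (hY : SmoothVField Y) (x : M) :
    der (antiLeeField J g θ) (ev ζ Y) x = ζ x (lie (antiLeeField J g θ) Y x) :=
  sub_eq_zero.1 ((hζ.2 _ hV.isLeafwise_antiLeeField).2 Y hY x)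

omit hV in
theorem smul (t : ℝ) (hV : IsVaisman J g θ) : IsBasicOneForm J g θ (t • ζ) :=
  isBasicOneForm_of_dOneForm (hζ.1.smul t)
    (fun x ↦ by simp only [Pi.smul_apply, smul_apply, hζ.apply_leeField hV, smul_zero])
    (fun x ↦ by simp only [Pi.smul_apply, smul_apply, hζ.apply_antiLeeField hV, smul_zero])
    (fun x v ↦ by rw [dOneForm_smul hζ.1, hζ.dOneForm_leeField hV, mul_zero])
    (fun x v ↦ by rw [dOneForm_smul hζ.1, hζ.dOneForm_antiLeeField hV, mul_zero])

end IsBasicOneForm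

theorem smoothOneForm_dc (hJ : SmoothEndField J) (hφ : SmoothFun (m := m) φ) :
    SmoothOneForm (dc J φ) :=
  (smoothOneForm_mvfderiv hφ).actOneForm hJ

/-- If `X` is holomorphic, `Xφ = 0` and `(d^c φ)(X) = 0`, then `ι_X d(d^c φ) = 0`. -/
theorem dOneForm_dc_of_holomorphic (hJ : SmoothEndField J) (hφ : SmoothFun (m := m) φ)
    (hX : SmoothVField X) (hXφ : ∀ x, der X φ x = 0) (hXc : ∀ x, dc J φ x (X x) = 0)
    (hXJ : ∀ Y, SmoothVField Y → ∀ x, lie X (app J Y) x = J x (lie X Y x)) (x : M)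
    (v : TangentSpace (𝓡 m) x) : dOneForm (dc J φ) x (X x) v = 0 := by
  obtain ⟨Y, hY, rfl⟩ := exists_smoothVField_apply_eq x v
  have hJY := hJ.apply hY
  have e1 : ev (dc J φ) Y = -der (app J Y) φ := rfl
  have e2 : ev (dc J φ) X = fun _ ↦ 0 := funext hXc
  have e3 : der X φ = fun _ ↦ 0 := funext hXφ
  -- As `Xφ = 0`, this reads `[X,JY]φ = X((JY)φ)`; holomorphicity turns the left side into
  -- `-(d^cφ)([X,Y])`.
  have h := congrFun (der_lie hX hJY hφ) x
  rw [Pi.sub_apply, e3, der_const, Pi.zero_apply] at h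
  have h2 : der (lie X (app J Y)) φ x = -dc J φ x (lie X Y x) := by
    simp only [der, hXJ Y hY]
    simp [dc, VaismanDeformation.actOneForm, dirDeriv]
  rw [dOneForm_fields (smoothOneForm_dc hJ hφ) hX hY, e1, e2, der_const, der_neg,
    Pi.zero_apply, Pi.neg_apply]
  linarith

theorem IsBasicFunction.isBasicOneForm_dc (hφ : IsBasicFunction J g θ φ)
    (hV : IsVaisman J g θ) : IsBasicOneForm J g θ (dc J φ) := by
  have hJ := hV.complex.smooth
  have hU : ∀ x, der (leeField g θ) φ x = 0 := hφ.2 _ hV.isLeafwise_leeField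
  have hV' : ∀ x, der (antiLeeField J g θ) φ x = 0 := hφ.2 _ hV.isLeafwise_antiLeeField
  have hcU : ∀ x, dc J φ x (leeField g θ x) = 0 := fun x ↦ by
    have h : mvfderiv (𝓡 m) φ x (antiLeeField J g θ x) = 0 := hV' x
    simp only [dc, actOneForm, neg_apply, ContinuousLinearMap.comp_apply, hV.app_leeField, h,
      neg_zero]
  have hcV : ∀ x, dc J φ x (antiLeeField J g θ x) = 0 := fun x ↦ by
    have h : mvfderiv (𝓡 m) φ x (leeField g θ x) = 0 := hU x
    simp only [dc, actOneForm, neg_apply, ContinuousLinearMap.comp_apply, hV.app_antiLeeField,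
      map_neg, h, neg_zero]
  exact isBasicOneForm_of_dOneForm (smoothOneForm_dc hJ hφ.1) hcU hcV
    (dOneForm_dc_of_holomorphic hJ hφ.1 hV.smoothVField_leeField hU hcU
      fun Y hY ↦ hV.lie_leeField_app hY)
    (dOneForm_dc_of_holomorphic hJ hφ.1 hV.smoothVField_antiLeeField hV' hcV
      fun Y hY ↦ hV.lie_antiLeeField_app hY)

theorem isOneOne_dOneForm_dc (hJ : IsComplexStructure J) (hφ : SmoothFun (m := m) φ) :
    IsOneOne J (dOneForm (dc J φ)) :=
  isOneOne_dOneForm_actOneForm hJ (smoothOneForm_mvfderiv hφ) (dOneForm_mvfderiv hφ)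

end Basic

/-! ### The deformation of a Vaisman structure by a basic 1-form -/

section Deformation

variable {m : ℕ} {M : Type*} [TopologicalSpace M] [ChartedSpace (EuclideanSpace ℝ (Fin m)) M]
  [IsManifold (𝓡 m) ∞ M]

variable {J : EndField m M} {g : SmoothMetric m M} {θ ζ : OneForm m M} {X Y Z : VField m M}

theorem deformedJ_apply (J : EndField m M) (g : SmoothMetric m M) (θ ζ : OneForm m M) (x : M)
    (v : TangentSpace (𝓡 m) x) : deformedJ J g θ ζ x v
      = J x v - ζ x v • leeField g θ x - ζ x (J x v) • antiLeeField J g θ x := rfl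

/-- The metric `g + dζ ∘ (J ⊗ Id) + ζ ⊗ θ^c + θ^c ⊗ ζ + ζ ⊗ ζ` as a tensor. -/
noncomputable def deformedMetric (J : EndField m M) (g : SmoothMetric m M) (θ ζ : OneForm m M) :
    TwoTensor m M := fun x v w ↦
  g.inner x v w + (dOneForm ζ x (J x v) w + ζ x v * antiLee J θ x w + antiLee J θ x v * ζ x w)
    + ζ x v * ζ x w

variable [T2Space M] (hV : IsVaisman J g θ) (hζ : IsBasicOneForm J g θ ζ)
  (h11 : IsOneOne J (dOneForm ζ))

include hV in
theorem IsVaisman.smoothOneForm_antiLee_add (hζ : SmoothOneForm ζ) :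
    SmoothOneForm (antiLee J θ + ζ) := hV.smoothOneForm_antiLee.add hζ

/-! ### Algebra of the deformed structure -/

include hV

omit [T2Space M] in
theorem app_deformedJ (x : M) (v : TangentSpace (𝓡 m) x) : J x (deformedJ J g θ ζ x v)
      = -v - ζ x v • antiLeeField J g θ x + ζ x (J x v) • leeField g θ x := by
  rw [deformedJ_apply, map_sub, map_sub, map_smul, map_smul, hV.app_leeField,
    hV.app_antiLeeField, hV.complex.sq]
  module

omit [T2Space M] in
-- The correction terms of `J_ζ` are chosen so that the anti-Lee form moves by exactly `ζ`.
theorem antiLee_deformedJ : antiLee (deformedJ J g θ ζ) θ = antiLee J θ + ζ := by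
  funext x
  ext v
  rw [antiLee_apply, deformedJ_apply, map_sub, map_sub, map_smul, map_smul, hV.theta_leeField,
    hV.theta_antiLeeField, Pi.add_apply, add_apply, antiLee_apply]
  simp only [smul_eq_mul]
  ring

omit [T2Space M] in
theorem theta_deformedJ (x : M) (v : TangentSpace (𝓡 m) x) :
    θ x (deformedJ J g θ ζ x v) = -(antiLee J θ + ζ) x v := by
  rw [← antiLee_deformedJ hV, antiLee_apply, neg_neg]

include hζ

theorem zeta_deformedJ (x : M) (v : TangentSpace (𝓡 m) x) :
    ζ x (deformedJ J g θ ζ x v) = ζ x (J x v) := by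
  rw [deformedJ_apply, map_sub, map_sub, map_smul, map_smul, hζ.apply_leeField hV,
    hζ.apply_antiLeeField hV, smul_zero, smul_zero, sub_zero, sub_zero]

theorem deformedJ_sq (x : M) (v : TangentSpace (𝓡 m) x) :
    deformedJ J g θ ζ x (deformedJ J g θ ζ x v) = -v := by
  rw [deformedJ_apply, zeta_deformedJ hV hζ, app_deformedJ hV, map_add, map_sub, map_smul,
    map_smul, hζ.apply_leeField hV, hζ.apply_antiLeeField hV, map_neg]
  module

theorem deformedJ_leeField (x : M) :
    deformedJ J g θ ζ x (leeField g θ x) = antiLeeField J g θ x := by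
  rw [deformedJ_apply, hV.app_leeField, hζ.apply_leeField hV, hζ.apply_antiLeeField hV]
  module

theorem antiLee_add_deformedJ (x : M) (v : TangentSpace (𝓡 m) x) :
    (antiLee J θ + ζ) x (deformedJ J g θ ζ x v) = θ x v := by
  rw [← antiLee_deformedJ hV, antiLee_apply, deformedJ_sq hV hζ, map_neg, neg_neg]

omit [T2Space M] in
theorem antiLee_add_leeField (x : M) : (antiLee J θ + ζ) x (leeField g θ x) = 0 := by
  rw [Pi.add_apply, add_apply, hV.antiLee_leeField, hζ.apply_leeField hV, add_zero]

theorem antiLee_add_antiLeeField (x : M) : (antiLee J θ + ζ) x (antiLeeField J g θ x) = 1 := by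
  rw [Pi.add_apply, add_apply, hV.antiLee_antiLeeField, hζ.apply_antiLeeField hV, add_zero]

theorem dOneForm_antiLee_add_leeField (x : M) (v : TangentSpace (𝓡 m) x) :
    dOneForm (antiLee J θ + ζ) x (leeField g θ x) v = 0 := by
  rw [dOneForm_add hV.smoothOneForm_antiLee hζ.1, hV.dOneForm_antiLee, fundForm_leeField_left,
    hV.theta_leeField, hV.antiLee_leeField, hζ.dOneForm_leeField hV]
  ring

theorem dOneForm_antiLee_add_antiLeeField (x : M) (v : TangentSpace (𝓡 m) x) :
    dOneForm (antiLee J θ + ζ) x (antiLeeField J g θ x) v = 0 := by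
  rw [dOneForm_add hV.smoothOneForm_antiLee hζ.1, hV.dOneForm_antiLee, fundForm,
    inner_antiLeeField, hV.theta_antiLeeField, hV.antiLee_antiLeeField,
    hζ.dOneForm_antiLeeField hV, hV.antiLee_app]
  ring

/-- `J_ζ v - J v` is leafwise, and leafwise vectors lie in the kernel of `d(θ^c + ζ)`. -/
theorem dOneForm_antiLee_add_deformedJ_left (x : M) (v w : TangentSpace (𝓡 m) x) :
    dOneForm (antiLee J θ + ζ) x (deformedJ J g θ ζ x v) w
      = dOneForm (antiLee J θ + ζ) x (J x v) w := by
  have hB := isBilinearMap_dOneForm (hV.smoothOneForm_antiLee_add hζ.1) x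
  rw [deformedJ_apply, sub_sub, sub_eq_add_neg, hB.add_left, ← neg_one_smul ℝ, hB.smul_left,
    hB.add_left, hB.smul_left, hB.smul_left, dOneForm_antiLee_add_leeField hV hζ,
    dOneForm_antiLee_add_antiLeeField hV hζ]
  simp

theorem dOneForm_antiLee_add_deformedJ_right (x : M) (v w : TangentSpace (𝓡 m) x) :
    dOneForm (antiLee J θ + ζ) x v (deformedJ J g θ ζ x w)
      = dOneForm (antiLee J θ + ζ) x v (J x w) := by
  rw [dOneForm_swap, dOneForm_antiLee_add_deformedJ_left hV hζ, ← dOneForm_swap]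

/-- The deformed metric has the form of `IsVaisman.inner_eq`, with `J_ζ` and `θ^c + ζ` in place of
`J` and `θ^c`. The remaining algebra rests on this. -/
theorem deformedMetric_eq (x : M) (v w : TangentSpace (𝓡 m) x) :
    deformedMetric J g θ ζ x v w
      = dOneForm (antiLee J θ + ζ) x (deformedJ J g θ ζ x v) w + θ x v * θ x w
        + (antiLee J θ + ζ) x v * (antiLee J θ + ζ) x w := by
  rw [dOneForm_antiLee_add_deformedJ_left hV hζ, dOneForm_add hV.smoothOneForm_antiLee hζ.1,
    deformedMetric, hV.inner_eq]
  simp only [Pi.add_apply, add_apply]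
  ring

theorem deformedMetric_leeField (x : M) (w : TangentSpace (𝓡 m) x) :
    deformedMetric J g θ ζ x (leeField g θ x) w = θ x w := by
  rw [deformedMetric_eq hV hζ, deformedJ_leeField hV hζ, antiLee_add_leeField hV hζ,
    dOneForm_antiLee_add_antiLeeField hV hζ, hV.theta_leeField]
  ring

theorem deformedMetric_antiLeeField (x : M) (w : TangentSpace (𝓡 m) x) :
    deformedMetric J g θ ζ x (antiLeeField J g θ x) w = (antiLee J θ + ζ) x w := by
  rw [deformedMetric_eq hV hζ, dOneForm_antiLee_add_deformedJ_left hV hζ, hV.app_antiLeeField,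
    antiLee_add_antiLeeField hV hζ, hV.theta_antiLeeField, ← neg_one_smul ℝ,
    (isBilinearMap_dOneForm (hV.smoothOneForm_antiLee_add hζ.1) x).smul_left,
    dOneForm_antiLee_add_leeField hV hζ]
  simp

omit hV hζ in
theorem isBilinearMap_deformedMetric (hζ : SmoothOneForm ζ) (x : M) :
    IsBilinearMap ℝ (deformedMetric J g θ ζ x) := by
  have hB := isBilinearMap_dOneForm hζ x
  constructor
  · intro u v w
    simp only [deformedMetric, map_add, add_apply, hB.add_left]
    ring
  · intro c u w
    simp only [deformedMetric, map_smul, smul_apply, hB.smul_left, smul_eq_mul]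
    ring
  · intro u v w
    simp only [deformedMetric, map_add, hB.add_right]
    ring
  · intro c u w
    simp only [deformedMetric, map_smul, hB.smul_right, smul_eq_mul]
    ring

omit hζ in
theorem smoothFun_deformedMetric (hζ : SmoothOneForm ζ) (hX : SmoothVField X)
    (hY : SmoothVField Y) : SmoothFun (m := m) (fun y ↦ deformedMetric J g θ ζ y (X y) (Y y)) :=
  have hc := hV.smoothOneForm_antiLee
  (((smoothFun_inner g hX hY).add (((smoothFun_dOneForm hζ (hV.complex.smooth.apply hX) hY).add
    ((hζ.apply hX).mul (hc.apply hY))).add ((hc.apply hX).mul (hζ.apply hY)))).add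
    ((hζ.apply hX).mul (hζ.apply hY)))

theorem smoothEndField_deformedJ : SmoothEndField (deformedJ J g θ ζ) :=
  .of_apply fun _ hX ↦
    have hJX := hV.complex.smooth.apply hX
    (hJX.sub (hV.smoothVField_leeField.smul (hζ.1.apply hX))).sub
      (hV.smoothVField_antiLeeField.smul (hζ.1.apply hJX))

include h11

theorem isOneOne_dOneForm_antiLee_add : IsOneOne J (dOneForm (antiLee J θ + ζ)) := by
  intro x v w
  simp only [dOneForm_add hV.smoothOneForm_antiLee hζ.1, hV.isOneOne_dOneForm_antiLee x v w,
    h11 x v w]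

theorem isOneOne_deformedJ : IsOneOne (deformedJ J g θ ζ) (dOneForm (antiLee J θ + ζ)) := by
  intro x v w
  rw [dOneForm_antiLee_add_deformedJ_left hV hζ, dOneForm_antiLee_add_deformedJ_right hV hζ,
    isOneOne_dOneForm_antiLee_add hV hζ h11]

/-- Symmetry of `dη(J_ζ·,·)` is equivalent to `dη` being `J_ζ`-invariant, because `dη` is skew and
`J_ζ² = -1`. -/
theorem deformedMetric_swap (x : M) (v w : TangentSpace (𝓡 m) x) :
    deformedMetric J g θ ζ x v w = deformedMetric J g θ ζ x w v := by
  have h := isOneOne_deformedJ hV hζ h11 x (deformedJ J g θ ζ x v) w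
  rw [deformedJ_sq hV hζ, ← neg_one_smul ℝ,
    (isBilinearMap_dOneForm (hV.smoothOneForm_antiLee_add hζ.1) x).smul_left, dOneForm_swap] at h
  rw [deformedMetric_eq hV hζ, deformedMetric_eq hV hζ, ← h, smul_eq_mul]
  ring

theorem deformedMetric_hermitian (x : M) (v w : TangentSpace (𝓡 m) x) :
    deformedMetric J g θ ζ x (deformedJ J g θ ζ x v) (deformedJ J g θ ζ x w)
      = deformedMetric J g θ ζ x v w := by
  rw [deformedMetric_eq hV hζ, deformedMetric_eq hV hζ, isOneOne_deformedJ hV hζ h11,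
    theta_deformedJ hV, theta_deformedJ hV, antiLee_add_deformedJ hV hζ,
    antiLee_add_deformedJ hV hζ]
  ring

theorem deformedMetric_app_right (x : M) (v w : TangentSpace (𝓡 m) x) :
    deformedMetric J g θ ζ x v (deformedJ J g θ ζ x w) = dOneForm (antiLee J θ + ζ) x v w
      - (θ x v * (antiLee J θ + ζ) x w - θ x w * (antiLee J θ + ζ) x v) := by
  rw [deformedMetric_eq hV hζ, isOneOne_deformedJ hV hζ h11, theta_deformedJ hV,
    antiLee_add_deformedJ hV hζ]
  ring

/-! ### Integrability of the deformed complex structure -/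

omit h11

/-- `U` preserves `J`, `U`, `V` and `ζ`, hence everything from which `J_ζ` is built. -/
theorem lie_leeField_deformedJ (hY : SmoothVField Y) (x : M) :
    lie (leeField g θ) (app (deformedJ J g θ ζ) Y) x
      = deformedJ J g θ ζ x (lie (leeField g θ) Y x) := by
  have hU := hV.smoothVField_leeField
  have hW := hV.smoothVField_antiLeeField
  have hJY := hV.complex.smooth.apply hY
  have e : app (deformedJ J g θ ζ) Y
      = app J Y - ev ζ Y • leeField g θ - ev ζ (app J Y) • antiLeeField J g θ := rfl
  have h0 : lie (leeField g θ) (leeField g θ) x = 0 := congrFun mlieBracket_self x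
  rw [e, lie_sub_right (hJY.sub (hU.smul (hζ.1.apply hY))) (hW.smul (hζ.1.apply hJY)),
    lie_sub_right hJY (hU.smul (hζ.1.apply hY)), lie_smul_right hU (hζ.1.apply hY),
    lie_smul_right hW (hζ.1.apply hJY), deformedJ_apply]
  simp only [Pi.sub_apply, Pi.add_apply, Pi.smul_apply', hV.lie_leeField_app hY, h0,
    hV.lie_leeField_antiLeeField, hζ.der_leeField hV hY, hζ.der_leeField hV hJY]
  module

theorem lie_antiLeeField_deformedJ (hY : SmoothVField Y) (x : M) :
    lie (antiLeeField J g θ) (app (deformedJ J g θ ζ) Y) x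
      = deformedJ J g θ ζ x (lie (antiLeeField J g θ) Y x) := by
  have hU := hV.smoothVField_leeField
  have hW := hV.smoothVField_antiLeeField
  have hJY := hV.complex.smooth.apply hY
  have e : app (deformedJ J g θ ζ) Y
      = app J Y - ev ζ Y • leeField g θ - ev ζ (app J Y) • antiLeeField J g θ := rfl
  have h0 : lie (antiLeeField J g θ) (antiLeeField J g θ) x = 0 := congrFun mlieBracket_self x
  have h1 : lie (antiLeeField J g θ) (leeField g θ) x = 0 := by
    rw [lie_swap, Pi.neg_apply, hV.lie_leeField_antiLeeField, neg_zero]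
  rw [e, lie_sub_right (hJY.sub (hU.smul (hζ.1.apply hY))) (hW.smul (hζ.1.apply hJY)),
    lie_sub_right hJY (hU.smul (hζ.1.apply hY)), lie_smul_right hU (hζ.1.apply hY),
    lie_smul_right hW (hζ.1.apply hJY), deformedJ_apply]
  simp only [Pi.sub_apply, Pi.add_apply, Pi.smul_apply', hV.lie_antiLeeField_app hY, h0, h1,
    hζ.der_antiLeeField hV hY, hζ.der_antiLeeField hV hJY]
  module

theorem lie_deformedJ_left (hX : SmoothVField X) (x : M) :
    lie (app (deformedJ J g θ ζ) X) Z x = lie (app J X) Z x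
      + der Z (ev ζ X) x • leeField g θ x - ζ x (X x) • lie (leeField g θ) Z x
      + der Z (ev ζ (app J X)) x • antiLeeField J g θ x
      - ζ x (J x (X x)) • lie (antiLeeField J g θ) Z x := by
  have hU := hV.smoothVField_leeField
  have hW := hV.smoothVField_antiLeeField
  have hJX := hV.complex.smooth.apply hX
  have e : app (deformedJ J g θ ζ) X
      = app J X - ev ζ X • leeField g θ - ev ζ (app J X) • antiLeeField J g θ := rfl
  rw [e, lie_sub_left (hJX.sub (hU.smul (hζ.1.apply hX))) (hW.smul (hζ.1.apply hJX)),
    lie_sub_left hJX (hU.smul (hζ.1.apply hX)), lie_smul_left hU (hζ.1.apply hX),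
    lie_smul_left hW (hζ.1.apply hJX)]
  simp only [Pi.sub_apply, Pi.add_apply, Pi.neg_apply, Pi.smul_apply']
  module

omit hV hζ [T2Space M] in
theorem der_deformedJ (f : M → ℝ) (x : M) : der (app (deformedJ J g θ ζ) Y) f x
      = der (app J Y) f x - ζ x (Y x) * der (leeField g θ) f x
        - ζ x (J x (Y x)) * der (antiLeeField J g θ) f x := by
  simp only [der, dirDeriv, app_apply, deformedJ_apply, map_sub, map_smul, smul_eq_mul]

include h11

theorem nijenhuis_deformedJ (hX : SmoothVField X) (hY : SmoothVField Y) (x : M) :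
    nijenhuis (deformedJ J g θ ζ) X Y x = 0 := by
  have hJ := hV.complex.smooth
  have hJX : SmoothVField (app J X) := hJ.apply hX
  have hJY : SmoothVField (app J Y) := hJ.apply hY
  have hc1 := hζ.der_leeField hV hX x
  have hc2 := hζ.der_leeField hV hJX x
  have hc3 := hζ.der_antiLeeField hV hX x
  have hc4 := hζ.der_antiLeeField hV hJX x
  rw [hV.lie_leeField_app hX] at hc2
  rw [hV.lie_antiLeeField_app hX] at hc4
  -- `E1` and `E2` expand the mixed brackets; `E3` and `E4` expand `[J_ζX, J_ζY]` one entry at a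
  -- time. The brackets with `U` and `V` cancel because both fields preserve `J_ζ`.
  have E1 := lie_deformedJ_left (Z := Y) hV hζ hX x
  have E2 := lie_deformedJ_left (Z := X) hV hζ hY x
  have E3 := lie_deformedJ_left (Z := app (deformedJ J g θ ζ) Y) hV hζ hX x
  have E4 := lie_deformedJ_left (Z := app J X) hV hζ hY x
  rw [lie_leeField_deformedJ hV hζ hY, lie_antiLeeField_deformedJ hV hζ hY,
    der_deformedJ, der_deformedJ, hc1, hc2, hc3, hc4, lie_swap (X := app J X),
    Pi.neg_apply] at E3
  rw [hV.lie_leeField_app hX, hV.lie_antiLeeField_app hX, lie_swap (X := app J Y) (Y := app J X),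
    Pi.neg_apply] at E4
  rw [E4] at E3
  rw [lie_swap (X := app J Y) (Y := X), Pi.neg_apply] at E2
  have hN : J x (J x (lie X Y x)) - J x (lie (app J X) Y x) - J x (lie X (app J Y) x)
    + lie (app J X) (app J Y) x = 0 := hV.complex.integrable X Y hX hY x
  rw [hV.complex.sq] at hN
  have hd1 := dOneForm_fields hζ.1 hX hY x
  have hd2 := dOneForm_fields hζ.1 hJX hJY x
  have hd3 := dOneForm_fields hζ.1 hJX hY x
  have hd4 := dOneForm_fields hζ.1 hX hJY x
  have h12 := h11 x (X x) (Y x)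
  have h34 := h11 x (X x) (J x (Y x))
  rw [hV.complex.sq, ← neg_one_smul ℝ, (isBilinearMap_dOneForm hζ.1 x).smul_right, smul_eq_mul] at h34
  have hN' := congrArg (ζ x) hN
  simp only [map_add, map_sub, map_neg, map_zero] at hN'
  have goal : nijenhuis (deformedJ J g θ ζ) X Y x = -lie X Y x
    - deformedJ J g θ ζ x (lie (app (deformedJ J g θ ζ) X) Y x)
    + deformedJ J g θ ζ x (lie (app (deformedJ J g θ ζ) Y) X x)
    + lie (app (deformedJ J g θ ζ) X) (app (deformedJ J g θ ζ) Y) x := by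
    rw [nijenhuis, deformedJ_sq hV hζ, lie_swap (X := app (deformedJ J g θ ζ) Y), Pi.neg_apply,
      map_neg]
    exact congrArg₂ _ (sub_eq_add_neg _ _) rfl
  simp only [app_apply] at hd2 hd3 hd4
  -- `hs1` and `hs2` are the coefficients of `U` and `V` in `N_ζ - N`. The first is `-(dζ(X,JY) +
  -- dζ(JX,Y))`; the second is `dζ(X,Y) - dζ(JX,JY)` rewritten by means of `ζ(N(X,Y)) = 0`.
  have hs1 : der (app J Y) (ev ζ X) x + der Y (ev ζ (app J X)) x - der (app J X) (ev ζ Y) x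
      - der X (ev ζ (app J Y)) x + ζ x (lie (app J X) Y x) + ζ x (lie X (app J Y) x) = 0 := by
    linarith
  have hs2 : -der Y (ev ζ X) x + der (app J Y) (ev ζ (app J X)) x + der X (ev ζ Y) x
      - der (app J X) (ev ζ (app J Y)) x + ζ x (J x (lie (app J X) Y x))
      + ζ x (J x (lie X (app J Y) x)) = 0 := by
    linarith
  rw [goal, E1, E2, E3]
  simp only [map_add, map_sub, map_smul, map_neg, deformedJ_apply, hV.app_leeField,
    hV.app_antiLeeField, hζ.apply_leeField hV, hζ.apply_antiLeeField hV]
  linear_combination (norm := module) hN + hs1 • leeField g θ x + hs2 • antiLeeField J g θ x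

/-- A basic 1-form `ζ` with `dζ` of type (1,1), such that the deformed metric is positive, defines
a Vaisman deformation with the same Lee form and the same canonical foliation. -/
theorem exists_isVaisman_deformedJ
    (hpos : ∀ x v, v ≠ 0 → 0 < deformedMetric J g θ ζ x v v) :
    ∃ g' : SmoothMetric m M, (∀ x v w, g'.inner x v w = deformedMetric J g θ ζ x v w) ∧
      IsVaisman (deformedJ J g θ ζ) g' θ ∧ leeField g' θ = leeField g θ ∧
      antiLeeField (deformedJ J g θ ζ) g' θ = antiLeeField J g θ := by
  obtain ⟨g', hg'⟩ := exists_smoothMetric (deformedMetric J g θ ζ)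
    (fun x ↦ isBilinearMap_deformedMetric hζ.1 x) (deformedMetric_swap hV hζ h11) hpos
    (fun X Y hX hY ↦ smoothFun_deformedMetric hV hζ.1 hX hY)
  have hU : sharp g' θ = leeField g θ := funext fun x ↦ metric_ext g' fun w ↦ by
    rw [sharp_spec, hg', deformedMetric_leeField hV hζ]
  have hW : sharp g' (antiLee (deformedJ J g θ ζ) θ) = antiLeeField J g θ :=
    funext fun x ↦ metric_ext g' fun w ↦ by
      rw [sharp_spec, hg', deformedMetric_antiLeeField hV hζ, antiLee_deformedJ hV]
  have hη := hV.smoothOneForm_antiLee_add hζ.1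
  have hJ' := smoothEndField_deformedJ hV hζ
  have hUs := hV.smoothVField_leeField
  refine ⟨g', hg', ⟨⟨hJ', deformedJ_sq hV hζ, fun X Y hX hY ↦ nijenhuis_deformedJ hV hζ h11 hX hY⟩,
    fun x v w ↦ ?_, hV.smooth, fun x ↦ ?_, ?_, fun X Y Z hX hY hZ x ↦ ?_⟩, hU, hW⟩
  · rw [hg', hg', deformedMetric_hermitian hV hζ h11]
  · rw [sharp_spec, hU, hV.theta_leeField]
  · obtain ⟨D, hD, -⟩ := hV.parallel
    obtain ⟨D', hD'⟩ := exists_isLeviCivita hD g'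
    refine isParallel_of_isKilling hD' hV.smooth hV.dOneForm_theta fun Y Z hY hZ x ↦ ?_
    have hJY := hJ'.apply hY
    -- Together with `ι_U dη = 0`, the identity `d(dη) = 0` says that `U` preserves `dη`. As `U`
    -- also preserves `J_ζ`, `θ` and `η`, it preserves the metric.
    have hd := dTwoFormOn_dOneForm hη hUs hJY hZ x
    have e0 : (fun y ↦ dOneForm (antiLee J θ + ζ) y (leeField g θ y) (deformedJ J g θ ζ y (Y y)))
        = fun _ ↦ 0 := funext fun y ↦ dOneForm_antiLee_add_leeField hV hζ y _
    have e0' : (fun y ↦ dOneForm (antiLee J θ + ζ) y (Z y) (leeField g θ y)) = fun _ ↦ 0 :=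
      funext fun y ↦ by rw [dOneForm_swap, dOneForm_antiLee_add_leeField hV hζ, neg_zero]
    rw [dTwoFormOn_eq_der, e0, e0', der_const, der_const,
      dOneForm_swap x _ (leeField g θ x), dOneForm_antiLee_add_leeField hV hζ,
      dOneForm_swap x (lie Z (leeField g θ) x), lie_swap (X := Z), Pi.neg_apply,
      ← neg_one_smul ℝ (lie _ _ _), (isBilinearMap_dOneForm hη x).smul_right,
      show lie (leeField g θ) (fun y ↦ deformedJ J g θ ζ y (Y y)) x = _ from
        lie_leeField_deformedJ hV hζ hY x] at hd
    have e1 : (fun y ↦ g'.inner y (Y y) (Z y))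
        = (fun y ↦ dOneForm (antiLee J θ + ζ) y (deformedJ J g θ ζ y (Y y)) (Z y))
          + ev θ Y * ev θ Z + ev (antiLee J θ + ζ) Y * ev (antiLee J θ + ζ) Z := by
      funext y
      rw [hg', deformedMetric_eq hV hζ]
      rfl
    have hη' (Y : VField m M) (hY : SmoothVField Y) :
        der (leeField g θ) (ev (antiLee J θ + ζ) Y) x
          = (antiLee J θ + ζ) x (lie (leeField g θ) Y x) := by
      have e : ev (antiLee J θ + ζ) Y = ev (antiLee J θ) Y + ev ζ Y := rfl
      rw [e, der_add (hV.smoothOneForm_antiLee.apply hY) (hζ.1.apply hY), Pi.add_apply,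
        hV.der_leeField_antiLee hY, hζ.der_leeField hV hY]
      rfl
    have hs1 := smoothFun_dOneForm hη hJY hZ
    have hs2 := (hV.smooth.apply hY).mul (hV.smooth.apply hZ)
    rw [hU, e1, der_add (hs1.add hs2) ((hη.apply hY).mul (hη.apply hZ)), der_add hs1 hs2,
      der_mul (hV.smooth.apply hY) (hV.smooth.apply hZ), der_mul (hη.apply hY) (hη.apply hZ)]
    have hB := deformedMetric_eq hV hζ x
    have hY' := hη' Y hY
    have hZ' := hη' Z hZ
    -- The sum is made opaque so that the simplification below does not split it.
    generalize antiLee J θ + ζ = η at hd hB hY' hZ' ⊢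
    simp only [Pi.add_apply, Pi.mul_apply, hY', hZ', hV.der_leeField_theta hY,
      hV.der_leeField_theta hZ, hg', hB]
    simp only [Pi.zero_apply, smul_eq_mul] at hd
    linarith
  · refine dTwoFormOn_eq_wedgeOneTwo hV.smooth hη hV.dOneForm_theta (fun x v w ↦ ?_) hX hY hZ x
    rw [fundForm, hg', deformedMetric_app_right hV hζ h11]

end Deformation

/-! ### Small deformations on compact manifolds -/

section Small

variable {m : ℕ} {M : Type*} [TopologicalSpace M] [ChartedSpace (EuclideanSpace ℝ (Fin m)) M]
  [IsManifold (𝓡 m) ∞ M]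

variable {J : EndField m M} {g : SmoothMetric m M} {θ ζ : OneForm m M} {φ : M → ℝ}

theorem exists_bound_of_isBilinearMap [T2Space M] [CompactSpace M] (g : SmoothMetric m M)
    {B : TwoTensor m M} (hB : ∀ x, IsBilinearMap ℝ (B x))
    (hs : ∀ X Y : VField m M, SmoothVField X → SmoothVField Y →
      SmoothFun (m := m) (fun y ↦ B y (X y) (Y y))) :
    ∃ C : ℝ, 0 < C ∧ ∀ x v w, |B x v w| ≤ C * (√(g.inner x v v) * √(g.inner x w w)) := by
  obtain ⟨β, hβ⟩ := exists_bilin B hB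
  obtain ⟨C, hC, h⟩ := exists_bound_of_contMDiff g (β := β)
    (contMDiff_bilin_of_apply fun X Y hX hY ↦ by simpa only [hβ] using hs X Y hX hY)
  exact ⟨C, hC, fun x v w ↦ by rw [← hβ]; exact h x v w⟩

theorem smallness_pos {n : ℕ} (hn : 1 ≤ n) : 0 < smallness n := by
  have h1 : (1 : ℝ) < 2 ^ (n + 1) := one_lt_pow₀ (by norm_num) (by omega)
  have h2 : (0 : ℝ) < n := by exact_mod_cast hn
  exact div_pos one_pos (mul_pos (sub_pos.2 h1) (Real.rpow_pos_of_pos h2 _))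

theorem oneFormNormLT_of_forall_sq_le {α : OneForm m M} {C δ : ℝ} (hδ : 0 < δ)
    (h : ∀ x v, g.inner x v v = 1 → α x v ^ 2 ≤ C) (hC : m * C < δ ^ 2) :
    OneFormNormLT g α δ := by
  intro x e he
  rw [Real.sqrt_lt' hδ]
  refine lt_of_le_of_lt (Finset.sum_le_card_nsmul _ _ C fun i _ ↦ h x _ ?_) (by simpa using hC)
  rw [he, if_pos rfl]

/-- All `m²` index pairs are counted, so `C` must also bound the zero entries with `i ≥ j`. -/
theorem twoFormNormLT_of_forall_sq_le {β : TwoTensor m M} {C δ : ℝ} (hδ : 0 < δ) (hC0 : 0 ≤ C)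
    (h : ∀ x v w, g.inner x v v = 1 → g.inner x w w = 1 → β x v w ^ 2 ≤ C)
    (hC : m * (m * C) < δ ^ 2) : TwoFormNormLT g β δ := by
  intro x e he
  rw [Real.sqrt_lt' hδ]
  refine lt_of_le_of_lt (Finset.sum_le_card_nsmul _ _ (m * C) fun i _ ↦
    (Finset.sum_le_card_nsmul _ _ C fun j _ ↦ ?_).trans (by simp)) (by simpa using hC)
  split_ifs
  · exact h x _ _ (by rw [he, if_pos rfl]) (by rw [he, if_pos rfl])
  · exact hC0

theorem deformedMetric_smul [T2Space M] (hζ : SmoothOneForm ζ) (t : ℝ) (x : M)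
    (v w : TangentSpace (𝓡 m) x) :
    deformedMetric J g θ (t • ζ) x v w = g.inner x v w
      + t * (dOneForm ζ x (J x v) w + ζ x v * antiLee J θ x w + antiLee J θ x v * ζ x w)
      + t ^ 2 * (ζ x v * ζ x w) := by
  rw [deformedMetric, dOneForm_smul hζ]
  simp only [Pi.smul_apply, smul_apply, smul_eq_mul]
  ring

/-- On a compact Vaisman manifold, small multiples of a basic 1-form with differential of type
(1,1) are small, and the corresponding deformed metrics are positive. -/
theorem eventually_small [T2Space M] [CompactSpace M] (hV : IsVaisman J g θ)
    (hζ : SmoothOneForm ζ) {δ : ℝ} (hδ : 0 < δ) :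
    ∀ᶠ t : ℝ in 𝓝 0, OneFormNormLT g (t • ζ) δ ∧ TwoFormNormLT g (dOneForm (t • ζ)) δ ∧
      (∀ x v, g.inner x v v = 1 → -1 < dOneForm (t • ζ) x (J x v) v) ∧
      ∀ x v, v ≠ 0 → 0 < deformedMetric J g θ (t • ζ) x v v := by
  have hc := hV.smoothOneForm_antiLee
  have hd := isBilinearMap_dOneForm hζ
  have hJ := hV.complex.smooth
  -- The constants bound `ζ ⊗ ζ`, `dζ` and the part of the deformed metric linear in `t`,
  -- respectively.
  obtain ⟨C₁, hC₁, h₁⟩ := exists_bound_of_isBilinearMap g (B := fun x v w ↦ ζ x v * ζ x w)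
    (fun x ↦ ⟨fun u v w ↦ by simp only [map_add]; ring,
      fun c u w ↦ by simp only [map_smul, smul_eq_mul]; ring,
      fun u v w ↦ by simp only [map_add]; ring,
      fun c u w ↦ by simp only [map_smul, smul_eq_mul]; ring⟩)
    (fun X Y hX hY ↦ (hζ.apply hX).mul (hζ.apply hY))
  obtain ⟨C₂, hC₂, h₂⟩ := exists_bound_of_isBilinearMap g hd
    (fun X Y hX hY ↦ smoothFun_dOneForm hζ hX hY)
  obtain ⟨C₃, hC₃, h₃⟩ := exists_bound_of_isBilinearMap g
    (B := fun x v w ↦ dOneForm ζ x (J x v) w + ζ x v * antiLee J θ x w + antiLee J θ x v * ζ x w)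
    (fun x ↦ ⟨fun u v w ↦ by simp only [map_add, (hd x).add_left]; ring,
      fun c u w ↦ by simp only [map_smul, (hd x).smul_left, smul_eq_mul]; ring,
      fun u v w ↦ by simp only [map_add, (hd x).add_right]; ring,
      fun c u w ↦ by simp only [map_smul, (hd x).smul_right, smul_eq_mul]; ring⟩)
    (fun X Y hX hY ↦ ((smoothFun_dOneForm hζ (hJ.apply hX) hY).add
      ((hζ.apply hX).mul (hc.apply hY))).add ((hc.apply hX).mul (hζ.apply hY)))
  have small (f : ℝ → ℝ) (hf : Continuous f) (hf0 : f 0 = 0) {c : ℝ} (hcpos : 0 < c) :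
      ∀ᶠ t : ℝ in 𝓝 0, f t < c :=
    hf.continuousAt.eventually_lt continuousAt_const (by rwa [hf0])
  filter_upwards [small (fun t ↦ m * (t ^ 2 * C₁)) (by fun_prop) (by simp) (pow_pos hδ 2),
    small (fun t ↦ m * (m * (t * C₂) ^ 2)) (by fun_prop) (by simp) (pow_pos hδ 2),
    small (fun t ↦ |t| * C₂) (by fun_prop) (by simp) one_pos,
    small (fun t ↦ |t| * C₃) (by fun_prop) (by simp) one_pos] with t ht₁ ht₂ ht₃ ht₄
  have hdt := dOneForm_smul hζ t
  have hd1 (x : M) (v w : TangentSpace (𝓡 m) x) (hv : g.inner x v v = 1)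
      (hw : g.inner x w w = 1) : |dOneForm (t • ζ) x v w| ≤ |t| * C₂ := by
    have h := h₂ x v w
    rw [hv, hw, Real.sqrt_one, mul_one, mul_one] at h
    rw [hdt, abs_mul]
    gcongr
  refine ⟨oneFormNormLT_of_forall_sq_le hδ (fun x v hv ↦ ?_) ht₁,
    twoFormNormLT_of_forall_sq_le hδ (sq_nonneg _) (fun x v w hv hw ↦ ?_) ht₂,
    fun x v hv ↦ ?_, fun x v hv ↦ ?_⟩
  · have h := h₁ x v v
    rw [hv, Real.sqrt_one, mul_one, mul_one] at h
    have h' := (le_abs_self _).trans h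
    have e : (t • ζ) x v ^ 2 = t ^ 2 * (ζ x v * ζ x v) := by
      simp only [Pi.smul_apply, smul_apply, smul_eq_mul]
      ring
    rw [e]
    gcongr
  · rw [← sq_abs, ← sq_abs (t * C₂), abs_mul t, abs_of_pos hC₂]
    gcongr
    exact hd1 x v w hv hw
  -- `J` is an isometry, so `Jv` is a unit vector too and `|dζ_t(Jv,v)| ≤ |t| C₂ < 1`.
  · have h := hd1 x (J x v) v ((hV.hermitian x v v).trans hv) hv
    linarith [neg_le_of_abs_le h]
  · have hp := g.pos x v hv
    have h := h₃ x v v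
    rw [Real.mul_self_sqrt hp.le] at h
    rw [deformedMetric_smul hζ]
    have h' := neg_le_of_abs_le ((abs_mul t _).le.trans (mul_le_mul_of_nonneg_left h (abs_nonneg t)))
    -- Only the linear term has to be dominated by `g`; the quadratic term is a square.
    have h'' : |t| * (C₃ * g.inner x v v) < g.inner x v v := by
      rw [← mul_assoc]
      exact mul_lt_of_lt_one_left hp ht₄
    have h3 : 0 ≤ t ^ 2 * (ζ x v * ζ x v) := mul_nonneg (sq_nonneg _) (mul_self_nonneg _)
    linarith

end Small

end VaismanDeformation

/-! ### The family of deformations defined by a basic function -/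

theorem mainTheorem3 (n : ℕ) (hn : 1 ≤ n) {M : Type*} [TopologicalSpace M] [T2Space M]
    [CompactSpace M] [ConnectedSpace M] [ChartedSpace (EuclideanSpace ℝ (Fin (2 * n + 2))) M]
    [IsManifold (𝓡 (2 * n + 2)) ∞ M]
    (J : EndField (2 * n + 2) M) (g : SmoothMetric (2 * n + 2) M) (θ : OneForm (2 * n + 2) M)
    (hV : IsVaisman J g θ) (φ : M → ℝ) (hφ : IsBasicFunction J g θ φ) :
    ∃ ε : ℝ, 0 < ε ∧ ∀ t : ℝ, |t| < ε →
      IsAdmissible n J g θ (t • dc J φ) ∧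
      ∃ gt : SmoothMetric (2 * n + 2) M,
        (∀ (x : M) (v w : TangentSpace (𝓡 (2 * n + 2)) x),
          gt.inner x v w = g.inner x v w
            + t * (dOneForm (dc J φ) x (J x v) w + dc J φ x v * antiLee J θ x w
                + antiLee J θ x v * dc J φ x w)
            + t ^ 2 * (dc J φ x v * dc J φ x w)) ∧
        IsVaisman (deformedJ J g θ (t • dc J φ)) gt θ ∧
        leeField gt θ = leeField g θ ∧
        antiLeeField (deformedJ J g θ (t • dc J φ)) gt θ = antiLeeField J g θ := by
  have hζ := hφ.isBasicOneForm_dc hV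
  have h11 := isOneOne_dOneForm_dc hV.complex hφ.1
  -- The bounds hold on a neighbourhood of 0, and `ε` is the radius of a ball in it; the only
  -- property of the smallness constant needed is positivity.
  obtain ⟨ε, hε, h⟩ := Metric.eventually_nhds_iff.1 (eventually_small hV hζ.1 (smallness_pos hn))
  refine ⟨ε, hε, fun t ht ↦ ?_⟩
  obtain ⟨h1, h2, h3, h4⟩ := h (y := t) (by simpa using ht)
  have hζt := hζ.smul t hV
  have h11t : IsOneOne J (dOneForm (t • dc J φ)) := fun x v w ↦ by
    rw [dOneForm_smul hζ.1, dOneForm_smul hζ.1, h11]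
  obtain ⟨gt, hgt, h5⟩ := exists_isVaisman_deformedJ hV hζt h11t h4
  exact ⟨⟨hζt, h11t, h1, h2, h3⟩, gt, fun x v w ↦ by rw [hgt, deformedMetric_smul hζ.1], h5⟩
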